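/- Let $A$ be a simple $C^*$-algebra (that is, $A\neq 0$ and the only norm-closed two-sided ideals of $A$ are $0$ and $A$), not assumed to be unital, let $X$ be a locally compact Hausdorff space, and let $C_0(X)$ be the $C^*$-algebra of continuous complex-valued functions on $X$ vanishing at infinity. Let $A\otimes^{\min}C_0(X)$ denote the minimal (spatial) $C^*$-tensor product, i.e. the completion of the algebraic tensor product $A\otimes C_0(X)$ with respect to the norm $\|t\|_{\min}=\sup\|(\pi\otimes\sigma)(t)\|$, the supremum being taken over all $*$-representations $\pi$ of $A$ and $\sigma$ of $C_0(X)$ on Hilbert spaces. For a subspace $S$ of an algebra $M$, let $N(S)=\{a\in M : ab-ba\in S \text{ for all } b\in M\}$ be its Lie normalizer. Then for every norm-closed two-sided ideal $I$ of $A\otimes^{\min}C_0(X)$, \[ N(I)=\begin{cases} I+\mathbb{C}1\otimes C_0(X), & \text{if } A \text{ is unital (with unit } 1),\\ I, & \text{if } A \text{ is non-unital,}\end{cases} \] where the Lie normalizer is taken in $A\otimes^{\min}C_0(X)$ and $\mathbb{C}1\otimes C_0(X)=\{1\otimes f : f\in C_0(X)\}$. -/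

import Mathlib

open scoped TensorProduct ZeroAtInfty

universe u v

noncomputable section

namespace CStarTensor

section HilbertTensor

variable (H : Type u) [NormedAddCommGroup H] [InnerProductSpace ℂ H]
variable (K : Type v) [NormedAddCommGroup K] [InnerProductSpace ℂ K]

/-- The Hilbert space tensor product of `H` and `K`: the completion of the algebraic tensor
product for the inner product `⟪h ⊗ k, h' ⊗ k'⟫ = ⟪h, h'⟫ * ⟪k, k'⟫`. -/
def HilbertTensor : Type (max u v) := UniformSpace.Completion (H ⊗[ℂ] K)

instance : NormedAddCommGroup (HilbertTensor H K) :=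
  inferInstanceAs (NormedAddCommGroup (UniformSpace.Completion (H ⊗[ℂ] K)))
instance : InnerProductSpace ℂ (HilbertTensor H K) :=
  inferInstanceAs (InnerProductSpace ℂ (UniformSpace.Completion (H ⊗[ℂ] K)))
instance : CompleteSpace (HilbertTensor H K) :=
  inferInstanceAs (CompleteSpace (UniformSpace.Completion (H ⊗[ℂ] K)))

/-- The canonical map of the algebraic tensor product into its completion. -/
def ofAlg : H ⊗[ℂ] K →ₗᵢ[ℂ] HilbertTensor H K :=
  (UniformSpace.Completion.toComplₗᵢ : H ⊗[ℂ] K →ₗᵢ[ℂ] UniformSpace.Completion (H ⊗[ℂ] K))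

lemma denseRange_ofAlg : DenseRange (ofAlg H K) :=
  UniformSpace.Completion.denseRange_coe (α := H ⊗[ℂ] K)

variable {H K}

/-- The elementary tensor `h ⊗ k` in the Hilbert space tensor product. -/
def hmul (h : H) (k : K) : HilbertTensor H K := ofAlg H K (h ⊗ₜ[ℂ] k)

/-- Two continuous additive maps that agree on elementary tensors are equal. -/
lemma hilbertTensor_ext {E : Type*} [AddMonoid E] [TopologicalSpace E] [T2Space E]
    {f g : HilbertTensor H K → E} (hf : Continuous f) (hg : Continuous g)
    (hf0 : f 0 = 0) (hg0 : g 0 = 0)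
    (hfa : ∀ x y, f (x + y) = f x + f y) (hga : ∀ x y, g (x + y) = g x + g y)
    (h : ∀ (a : H) (b : K), f (hmul a b) = g (hmul a b)) (x : HilbertTensor H K) : f x = g x := by
  refine isClosed_property (denseRange_ofAlg H K) (isClosed_eq hf hg) (fun t => ?_) x
  induction t with
  | zero => rw [map_zero, hf0, hg0]
  | add s t hs ht => rw [map_add, hfa, hga, hs, ht]
  | tmul a b => exact h a b

lemma hilbertTensor_clm_ext {S T : HilbertTensor H K →L[ℂ] HilbertTensor H K}
    (h : ∀ (a : H) (b : K), S (hmul a b) = T (hmul a b)) : S = T :=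
  ContinuousLinearMap.ext fun x => hilbertTensor_ext S.continuous T.continuous (map_zero S)
    (map_zero T) (map_add S) (map_add T) h x

lemma inner_hmul (h h' : H) (k k' : K) :
    inner ℂ (hmul h k) (hmul h' k') = inner ℂ h h' * inner ℂ k k' :=
  ((ofAlg H K).inner_map_map _ _).trans (TensorProduct.inner_tmul ℂ h h' k k')

/-- The bounded operator `S ⊗ T` on the Hilbert space tensor product. -/
def opTensor (S : H →L[ℂ] H) (T : K →L[ℂ] K) : HilbertTensor H K →L[ℂ] HilbertTensor H K :=
  ((TensorProduct.mapL S T).completion :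
    UniformSpace.Completion (H ⊗[ℂ] K) →L[ℂ] UniformSpace.Completion (H ⊗[ℂ] K))

lemma opTensor_ofAlg (S : H →L[ℂ] H) (T : K →L[ℂ] K) (t : H ⊗[ℂ] K) :
    opTensor S T (ofAlg H K t) = ofAlg H K (TensorProduct.mapL S T t) :=
  ContinuousLinearMap.completion_apply_coe (TensorProduct.mapL S T) t

@[simp] lemma opTensor_hmul (S : H →L[ℂ] H) (T : K →L[ℂ] K) (h : H) (k : K) :
    opTensor S T (hmul h k) = hmul (S h) (T k) :=
  opTensor_ofAlg S T (h ⊗ₜ[ℂ] k)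

lemma hmul_add_left (h h' : H) (k : K) : hmul (h + h') k = hmul h k + hmul h' k := by
  simp only [hmul, TensorProduct.add_tmul, map_add]

lemma hmul_add_right (h : H) (k k' : K) : hmul h (k + k') = hmul h k + hmul h k' := by
  simp only [hmul, TensorProduct.tmul_add, map_add]

lemma hmul_smul_left (c : ℂ) (h : H) (k : K) : hmul (c • h) k = c • hmul h k := by
  simp only [hmul, ← TensorProduct.smul_tmul', map_smul]

lemma hmul_smul_right (c : ℂ) (h : H) (k : K) : hmul h (c • k) = c • hmul h k := by
  simp only [hmul, TensorProduct.tmul_smul, map_smul]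

lemma norm_opTensor_le (S : H →L[ℂ] H) (T : K →L[ℂ] K) : ‖opTensor S T‖ ≤ ‖S‖ * ‖T‖ := by
  refine ContinuousLinearMap.opNorm_le_bound _ (by positivity) fun x => ?_
  refine isClosed_property (denseRange_ofAlg H K)
    (isClosed_le (opTensor S T).continuous.norm (continuous_const.mul continuous_norm))
    (fun t => ?_) x
  change ‖opTensor S T (ofAlg H K t)‖ ≤ ‖S‖ * ‖T‖ * ‖ofAlg H K t‖
  rw [opTensor_ofAlg, LinearIsometry.norm_map, LinearIsometry.norm_map]
  exact ((TensorProduct.mapL S T).le_opNorm t).trans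
    (mul_le_mul_of_nonneg_right (TensorProduct.norm_mapL_le S T) (norm_nonneg t))

lemma opTensor_adjoint [CompleteSpace H] [CompleteSpace K] (S : H →L[ℂ] H) (T : K →L[ℂ] K) :
    opTensor (star S) (star T) = star (opTensor S T) := by
  refine hilbertTensor_clm_ext fun h k => ?_
  refine ext_inner_right ℂ fun x => ?_
  refine hilbertTensor_ext (by fun_prop) (by fun_prop) (by simp) (by simp)
    (fun x y => inner_add_right _ _ _) (fun x y => inner_add_right _ _ _) (fun h' k' => ?_) x
  simp only [ContinuousLinearMap.star_eq_adjoint, ContinuousLinearMap.adjoint_inner_left,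
    opTensor_hmul, inner_hmul]

end HilbertTensor

section Spatial

variable {A : Type u} {B : Type v} [NonUnitalCStarAlgebra A] [NonUnitalCStarAlgebra B]
variable {H : Type u} [NormedAddCommGroup H] [InnerProductSpace ℂ H] [CompleteSpace H]
variable {K : Type v} [NormedAddCommGroup K] [InnerProductSpace ℂ K] [CompleteSpace K]

/-- For `*`-representations `π` of `A` on `H` and `σ` of `B` on `K`, the linear map `π ⊗ σ` from
`A ⊗ B` to the bounded operators on the Hilbert space `H ⊗ K`, with
`(π ⊗ σ) (a ⊗ b) = π a ⊗ σ b`. -/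
def repTensor (π : A →⋆ₙₐ[ℂ] (H →L[ℂ] H)) (σ : B →⋆ₙₐ[ℂ] (K →L[ℂ] K)) :
    A ⊗[ℂ] B →ₗ[ℂ] (HilbertTensor H K →L[ℂ] HilbertTensor H K) :=
  TensorProduct.lift (LinearMap.mk₂ ℂ (fun a b => opTensor (π a) (σ b))
    (fun a a' b => hilbertTensor_clm_ext fun h k => by simp [hmul_add_left])
    (fun c a b => hilbertTensor_clm_ext fun h k => by simp [hmul_smul_left])
    (fun a b b' => hilbertTensor_clm_ext fun h k => by simp [hmul_add_right])
    (fun c a b => hilbertTensor_clm_ext fun h k => by simp [hmul_smul_right]))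

@[simp] lemma repTensor_tmul (π : A →⋆ₙₐ[ℂ] (H →L[ℂ] H)) (σ : B →⋆ₙₐ[ℂ] (K →L[ℂ] K))
    (a : A) (b : B) : repTensor π σ (a ⊗ₜ b) = opTensor (π a) (σ b) := rfl

lemma repTensor_mul (π : A →⋆ₙₐ[ℂ] (H →L[ℂ] H)) (σ : B →⋆ₙₐ[ℂ] (K →L[ℂ] K))
    (s t : A ⊗[ℂ] B) : repTensor π σ (s * t) = repTensor π σ s * repTensor π σ t := by
  induction s with
  | zero => simp
  | add x y hx hy => rw [add_mul, map_add, map_add, add_mul, hx, hy]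
  | tmul a b =>
    induction t with
    | zero => simp
    | add x y hx hy => rw [mul_add, map_add, map_add, mul_add, hx, hy]
    | tmul a' b' => exact hilbertTensor_clm_ext fun h k => by simp

lemma repTensor_star (π : A →⋆ₙₐ[ℂ] (H →L[ℂ] H)) (σ : B →⋆ₙₐ[ℂ] (K →L[ℂ] K))
    (t : A ⊗[ℂ] B) : repTensor π σ (star t) = star (repTensor π σ t) := by
  induction t with
  | zero => simp
  | add s t hs ht => rw [star_add, map_add, map_add, star_add, hs, ht]
  | tmul a b =>
    rw [TensorProduct.star_tmul, repTensor_tmul, repTensor_tmul, map_star, map_star,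
      opTensor_adjoint]

end Spatial

section MinNorm

variable {A : Type u} {B : Type v} [NonUnitalCStarAlgebra A] [NonUnitalCStarAlgebra B]

/-- The set of all numbers `‖(π ⊗ σ) t‖`, where `π` and `σ` run over the `*`-representations of
`A` and of `B` on Hilbert spaces. -/
def repNorms (t : A ⊗[ℂ] B) : Set ℝ :=
  {r | ∃ (H : Type u) (_ : NormedAddCommGroup H) (_ : InnerProductSpace ℂ H) (_ : CompleteSpace H)
      (K : Type v) (_ : NormedAddCommGroup K) (_ : InnerProductSpace ℂ K) (_ : CompleteSpace K)
      (π : A →⋆ₙₐ[ℂ] (H →L[ℂ] H)) (σ : B →⋆ₙₐ[ℂ] (K →L[ℂ] K)), r = ‖repTensor π σ t‖}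

/-- The minimal (spatial) C⋆-norm on the algebraic tensor product `A ⊗ B`:
the supremum of `‖(π ⊗ σ) t‖` over all pairs of `*`-representations `π` of `A`, `σ` of `B`. -/
def minNorm (t : A ⊗[ℂ] B) : ℝ := sSup (repNorms t)

lemma repNorms_nonempty (t : A ⊗[ℂ] B) : (repNorms t).Nonempty :=
  ⟨_, PUnit.{u + 1}, inferInstance, inferInstance, inferInstance,
    PUnit.{v + 1}, inferInstance, inferInstance, inferInstance, 0, 0, rfl⟩

lemma bddAbove_repNorms (t : A ⊗[ℂ] B) : BddAbove (repNorms t) := by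
  induction t with
  | zero =>
    refine ⟨0, ?_⟩
    rintro r ⟨H, _, _, _, K, _, _, _, π, σ, rfl⟩
    simp
  | add s t hs ht =>
    obtain ⟨c, hc⟩ := hs
    obtain ⟨d, hd⟩ := ht
    refine ⟨c + d, ?_⟩
    rintro r ⟨H, _, _, _, K, _, _, _, π, σ, rfl⟩
    rw [map_add]
    exact (norm_add_le _ _).trans (add_le_add
      (hc ⟨H, inferInstance, inferInstance, inferInstance, K, inferInstance, inferInstance,
        inferInstance, π, σ, rfl⟩)
      (hd ⟨H, inferInstance, inferInstance, inferInstance, K, inferInstance, inferInstance,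
        inferInstance, π, σ, rfl⟩))
  | tmul a b =>
    refine ⟨‖a‖ * ‖b‖, ?_⟩
    rintro r ⟨H, _, _, _, K, _, _, _, π, σ, rfl⟩
    rw [repTensor_tmul]
    exact (norm_opTensor_le _ _).trans (mul_le_mul (NonUnitalStarAlgHom.norm_apply_le π a)
      (NonUnitalStarAlgHom.norm_apply_le σ b) (norm_nonneg _) (norm_nonneg _))

lemma norm_repTensor_le_minNorm {H : Type u} [NormedAddCommGroup H] [InnerProductSpace ℂ H]
    [CompleteSpace H] {K : Type v} [NormedAddCommGroup K] [InnerProductSpace ℂ K] [CompleteSpace K]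
    (π : A →⋆ₙₐ[ℂ] (H →L[ℂ] H)) (σ : B →⋆ₙₐ[ℂ] (K →L[ℂ] K)) (t : A ⊗[ℂ] B) :
    ‖repTensor π σ t‖ ≤ minNorm t :=
  le_csSup (bddAbove_repNorms t)
    ⟨H, inferInstance, inferInstance, inferInstance, K, inferInstance, inferInstance,
      inferInstance, π, σ, rfl⟩

lemma minNorm_le {t : A ⊗[ℂ] B} {c : ℝ}
    (h : ∀ (H : Type u) [NormedAddCommGroup H] [InnerProductSpace ℂ H] [CompleteSpace H]
      (K : Type v) [NormedAddCommGroup K] [InnerProductSpace ℂ K] [CompleteSpace K]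
      (π : A →⋆ₙₐ[ℂ] (H →L[ℂ] H)) (σ : B →⋆ₙₐ[ℂ] (K →L[ℂ] K)), ‖repTensor π σ t‖ ≤ c) :
    minNorm t ≤ c := by
  refine csSup_le (repNorms_nonempty t) ?_
  rintro r ⟨H, _, _, _, K, _, _, _, π, σ, rfl⟩
  exact h H K π σ

lemma minNorm_nonneg (t : A ⊗[ℂ] B) : 0 ≤ minNorm t := by
  obtain ⟨r, hr⟩ := repNorms_nonempty t
  refine le_csSup_of_le (bddAbove_repNorms t) hr ?_
  obtain ⟨H, _, _, _, K, _, _, _, π, σ, rfl⟩ := hr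
  exact norm_nonneg _

lemma minNorm_zero : minNorm (0 : A ⊗[ℂ] B) = 0 :=
  le_antisymm (minNorm_le fun H _ _ _ K _ _ _ π σ => by simp) (minNorm_nonneg _)

lemma minNorm_add_le (s t : A ⊗[ℂ] B) : minNorm (s + t) ≤ minNorm s + minNorm t :=
  minNorm_le fun H _ _ _ K _ _ _ π σ => by
    rw [map_add]
    exact (norm_add_le _ _).trans
      (add_le_add (norm_repTensor_le_minNorm π σ s) (norm_repTensor_le_minNorm π σ t))

lemma minNorm_smul_le (c : ℂ) (t : A ⊗[ℂ] B) : minNorm (c • t) ≤ ‖c‖ * minNorm t :=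
  minNorm_le fun H _ _ _ K _ _ _ π σ => by
    rw [map_smul, norm_smul]
    gcongr
    exact norm_repTensor_le_minNorm π σ t

lemma minNorm_neg (t : A ⊗[ℂ] B) : minNorm (-t) = minNorm t := by
  have h : ∀ s : A ⊗[ℂ] B, minNorm (-s) ≤ minNorm s := fun s => by
    simpa using minNorm_smul_le (-1) s
  exact le_antisymm (h t) (by simpa using h (-t))

lemma minNorm_mul_le (s t : A ⊗[ℂ] B) : minNorm (s * t) ≤ minNorm s * minNorm t :=
  minNorm_le fun H _ _ _ K _ _ _ π σ => by
    rw [repTensor_mul]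
    exact (norm_mul_le _ _).trans (mul_le_mul (norm_repTensor_le_minNorm π σ s)
      (norm_repTensor_le_minNorm π σ t) (norm_nonneg _) (minNorm_nonneg _))

lemma minNorm_mul_self_le (t : A ⊗[ℂ] B) : minNorm t * minNorm t ≤ minNorm (star t * t) := by
  have h : minNorm t ≤ √(minNorm (star t * t)) :=
    minNorm_le fun H _ _ _ K _ _ _ π σ => by
      refine Real.le_sqrt_of_sq_le ?_
      rw [sq, ← CStarRing.norm_star_mul_self, ← repTensor_star, ← repTensor_mul]
      exact norm_repTensor_le_minNorm π σ _
  calc minNorm t * minNorm t ≤ √(minNorm (star t * t)) * √(minNorm (star t * t)) :=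
        mul_self_le_mul_self (minNorm_nonneg t) h
    _ = _ := Real.mul_self_sqrt (minNorm_nonneg _)

lemma minNorm_star (t : A ⊗[ℂ] B) : minNorm (star t) = minNorm t := by
  have h : ∀ s : A ⊗[ℂ] B, minNorm s ≤ minNorm (star s) := fun s => by
    rcases (minNorm_nonneg s).eq_or_lt with h0 | h0
    · rw [← h0]; exact minNorm_nonneg _
    · exact le_of_mul_le_mul_right ((minNorm_mul_self_le s).trans (minNorm_mul_le _ _)) h0
  exact le_antisymm (by simpa using h (star t)) (h t)

end MinNorm

variable (A : Type u) (B : Type v) [NonUnitalCStarAlgebra A] [NonUnitalCStarAlgebra B]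

/-- The algebraic tensor product `A ⊗ B`, to be equipped with the minimal norm. -/
def PreMin : Type (max u v) := A ⊗[ℂ] B

namespace PreMin

instance : NonUnitalRing (PreMin A B) := inferInstanceAs (NonUnitalRing (A ⊗[ℂ] B))
instance : StarRing (PreMin A B) := inferInstanceAs (StarRing (A ⊗[ℂ] B))
instance : Module ℂ (PreMin A B) := inferInstanceAs (Module ℂ (A ⊗[ℂ] B))
instance : StarModule ℂ (PreMin A B) := inferInstanceAs (StarModule ℂ (A ⊗[ℂ] B))
instance : IsScalarTower ℂ (PreMin A B) (PreMin A B) :=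
  inferInstanceAs (IsScalarTower ℂ (A ⊗[ℂ] B) (A ⊗[ℂ] B))
instance : SMulCommClass ℂ (PreMin A B) (PreMin A B) :=
  inferInstanceAs (SMulCommClass ℂ (A ⊗[ℂ] B) (A ⊗[ℂ] B))

/-- The minimal norm, as a seminorm on the additive group `A ⊗ B`. -/
def groupSeminorm : AddGroupSeminorm (PreMin A B) where
  toFun t := minNorm (A := A) (B := B) t
  map_zero' := minNorm_zero
  add_le' := minNorm_add_le
  neg' := minNorm_neg

instance : SeminormedAddCommGroup (PreMin A B) :=
  (groupSeminorm A B).toSeminormedAddCommGroup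

instance : NonUnitalSeminormedRing (PreMin A B) where
  __ := (inferInstance : SeminormedAddCommGroup (PreMin A B))
  __ := (inferInstance : NonUnitalRing (PreMin A B))
  norm_mul_le := minNorm_mul_le

instance : NormedSpace ℂ (PreMin A B) where
  norm_smul_le := minNorm_smul_le

instance : NormedStarGroup (PreMin A B) where
  norm_star_le t := (minNorm_star (A := A) (B := B) t).le

end PreMin

/-- The minimal C⋆-tensor product of `A` and `B`: the completion of the algebraic tensor product
`A ⊗ B` with respect to the minimal norm. -/
def MinTensor : Type (max u v) := UniformSpace.Completion (PreMin A B)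

namespace MinTensor

open UniformSpace UniformSpace.Completion

instance : NormedAddCommGroup (MinTensor A B) :=
  inferInstanceAs (NormedAddCommGroup (Completion (PreMin A B)))

/-- The scalar multiplication of the completion. -/
def smul (c : ℂ) (x : MinTensor A B) : MinTensor A B :=
  (c • (show Completion (PreMin A B) from x) : Completion (PreMin A B))

instance : NormedSpace ℂ (MinTensor A B) where
  smul := smul A B
  one_smul x := one_smul ℂ (show Completion (PreMin A B) from x)
  mul_smul c d x := mul_smul c d (show Completion (PreMin A B) from x)
  smul_zero c := smul_zero (A := Completion (PreMin A B)) c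
  smul_add c x y := smul_add (A := Completion (PreMin A B)) c x y
  add_smul c d x := add_smul c d (show Completion (PreMin A B) from x)
  zero_smul x := zero_smul ℂ (show Completion (PreMin A B) from x)
  norm_smul_le c x := norm_smul_le c (show Completion (PreMin A B) from x)

instance : CompleteSpace (MinTensor A B) :=
  inferInstanceAs (CompleteSpace (Completion (PreMin A B)))

/-- The canonical map of the algebraic tensor product, with the minimal norm, into its
completion. -/
def ofPre : PreMin A B →ₗᵢ[ℂ] MinTensor A B :=
  (toComplₗᵢ : PreMin A B →ₗᵢ[ℂ] Completion (PreMin A B))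

lemma denseRange_ofPre : DenseRange (ofPre A B) :=
  denseRange_coe (α := PreMin A B)

lemma isDenseInducing_ofPre : IsDenseInducing (ofPre A B) :=
  isDenseInducing_coe (α := PreMin A B)

/-- The product on the completion is the continuous extension of the product on `A ⊗ B`. -/
def mul (x y : MinTensor A B) : MinTensor A B :=
  ((isDenseInducing_ofPre A B).prodMap (isDenseInducing_ofPre A B)).extend
    (fun p : PreMin A B × PreMin A B => ofPre A B (p.1 * p.2)) (x, y)

instance : Mul (MinTensor A B) := ⟨mul A B⟩

/-- The involution on the completion is the continuous extension of the involution on `A ⊗ B`. -/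
def conj : MinTensor A B → MinTensor A B :=
  (isDenseInducing_ofPre A B).extend (fun t : PreMin A B => ofPre A B (star t))

instance : Star (MinTensor A B) := ⟨conj A B⟩

variable {A B}

lemma ofPre_mul (s t : PreMin A B) : ofPre A B (s * t) = ofPre A B s * ofPre A B t :=
  (((isDenseInducing_ofPre A B).prodMap (isDenseInducing_ofPre A B)).extend_eq
    (f := fun p : PreMin A B × PreMin A B => ofPre A B (p.1 * p.2))
    ((ofPre A B).continuous.comp continuous_mul) (s, t)).symm

lemma ofPre_star (t : PreMin A B) : ofPre A B (star t) = star (ofPre A B t) :=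
  ((isDenseInducing_ofPre A B).extend_eq (f := fun t : PreMin A B => ofPre A B (star t))
    ((ofPre A B).continuous.comp continuous_star) t).symm

instance : ContinuousMul (MinTensor A B) where
  continuous_mul := by
    let i : PreMin A B →+ MinTensor A B := (ofPre A B).toLinearMap.toAddMonoidHom
    let m := (AddMonoidHom.mul : PreMin A B →+ PreMin A B →+ PreMin A B).compr₂ i
    have hm : Continuous fun p : PreMin A B × PreMin A B => m p.1 p.2 :=
      (ofPre A B).continuous.comp continuous_mul
    have di : IsDenseInducing i := isDenseInducing_ofPre A B
    exact (di.extend_Z_bilin di hm :)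

instance : ContinuousStar (MinTensor A B) where
  continuous_star :=
    (uniformContinuous_uniformly_extend (ofPre A B).isometry.isUniformInducing
      (denseRange_ofPre A B) ((ofPre A B).isometry.comp star_isometry).uniformContinuous).continuous

attribute [irreducible] mul conj smul

@[elab_as_elim]
lemma induction_on {p : MinTensor A B → Prop} (x : MinTensor A B)
    (hp : IsClosed {x | p x}) (h : ∀ t, p (ofPre A B t)) : p x :=
  isClosed_property (denseRange_ofPre A B) hp h x

protected lemma zero_mul' (a : MinTensor A B) : 0 * a = 0 := by
  refine induction_on a (isClosed_eq (by fun_prop) continuous_const) fun s => ?_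
  rw [← map_zero (ofPre A B), ← ofPre_mul, zero_mul]

protected lemma mul_zero' (a : MinTensor A B) : a * 0 = 0 := by
  refine induction_on a (isClosed_eq (by fun_prop) continuous_const) fun s => ?_
  rw [← map_zero (ofPre A B), ← ofPre_mul, mul_zero]

protected lemma mul_add' (a b c : MinTensor A B) : a * (b + c) = a * b + a * c := by
  refine induction_on a (isClosed_eq (by fun_prop) (by fun_prop)) fun s => ?_
  refine induction_on b (isClosed_eq (by fun_prop) (by fun_prop)) fun t => ?_
  refine induction_on c (isClosed_eq (by fun_prop) (by fun_prop)) fun r => ?_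
  rw [← map_add, ← ofPre_mul, ← ofPre_mul, ← ofPre_mul, ← map_add, mul_add]

protected lemma add_mul' (a b c : MinTensor A B) : (a + b) * c = a * c + b * c := by
  refine induction_on a (isClosed_eq (by fun_prop) (by fun_prop)) fun s => ?_
  refine induction_on b (isClosed_eq (by fun_prop) (by fun_prop)) fun t => ?_
  refine induction_on c (isClosed_eq (by fun_prop) (by fun_prop)) fun r => ?_
  rw [← map_add, ← ofPre_mul, ← ofPre_mul, ← ofPre_mul, ← map_add, add_mul]

protected lemma mul_assoc' (a b c : MinTensor A B) : a * b * c = a * (b * c) := by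
  refine induction_on a (isClosed_eq (by fun_prop) (by fun_prop)) fun s => ?_
  refine induction_on b (isClosed_eq (by fun_prop) (by fun_prop)) fun t => ?_
  refine induction_on c (isClosed_eq (by fun_prop) (by fun_prop)) fun r => ?_
  rw [← ofPre_mul, ← ofPre_mul, ← ofPre_mul, ← ofPre_mul, mul_assoc]

protected lemma norm_mul_le' (a b : MinTensor A B) : ‖a * b‖ ≤ ‖a‖ * ‖b‖ := by
  refine induction_on a (isClosed_le (by fun_prop) (by fun_prop)) fun s => ?_
  refine induction_on b (isClosed_le (by fun_prop) (by fun_prop)) fun t => ?_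
  rw [← ofPre_mul, LinearIsometry.norm_map, LinearIsometry.norm_map, LinearIsometry.norm_map]
  exact norm_mul_le s t

protected lemma smul_mul' (c : ℂ) (a b : MinTensor A B) : (c • a) * b = c • (a * b) := by
  refine induction_on a (isClosed_eq (by fun_prop) (by fun_prop)) fun s => ?_
  refine induction_on b (isClosed_eq (by fun_prop) (by fun_prop)) fun t => ?_
  rw [← map_smul, ← ofPre_mul, ← ofPre_mul, ← map_smul, smul_mul_assoc]

protected lemma mul_smul' (c : ℂ) (a b : MinTensor A B) : a * (c • b) = c • (a * b) := by
  refine induction_on a (isClosed_eq (by fun_prop) (by fun_prop)) fun s => ?_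
  refine induction_on b (isClosed_eq (by fun_prop) (by fun_prop)) fun t => ?_
  rw [← map_smul, ← ofPre_mul, ← ofPre_mul, ← map_smul, mul_smul_comm]

protected lemma star_smul' (c : ℂ) (a : MinTensor A B) : star (c • a) = star c • star a := by
  refine induction_on a (isClosed_eq (by fun_prop) (by fun_prop)) fun s => ?_
  rw [← map_smul, ← ofPre_star, ← ofPre_star, ← map_smul, star_smul]

instance : NonUnitalNormedRing (MinTensor A B) where
  __ := (inferInstance : NormedAddCommGroup (MinTensor A B))
  __ := (inferInstance : Mul (MinTensor A B))
  zero_mul := MinTensor.zero_mul'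
  mul_zero := MinTensor.mul_zero'
  left_distrib := MinTensor.mul_add'
  right_distrib := MinTensor.add_mul'
  mul_assoc := MinTensor.mul_assoc'
  norm_mul_le := MinTensor.norm_mul_le'

protected lemma star_star' (a : MinTensor A B) : star (star a) = a := by
  refine induction_on a (isClosed_eq (by fun_prop) (by fun_prop)) fun s => ?_
  rw [← ofPre_star, ← ofPre_star, star_star]

protected lemma star_mul' (a b : MinTensor A B) : star (a * b) = star b * star a := by
  refine induction_on a (isClosed_eq (by fun_prop) (by fun_prop)) fun s => ?_
  refine induction_on b (isClosed_eq (by fun_prop) (by fun_prop)) fun t => ?_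
  rw [← ofPre_mul, ← ofPre_star, ← ofPre_star, ← ofPre_star, ← ofPre_mul, star_mul]

protected lemma star_add' (a b : MinTensor A B) : star (a + b) = star a + star b := by
  refine induction_on a (isClosed_eq (by fun_prop) (by fun_prop)) fun s => ?_
  refine induction_on b (isClosed_eq (by fun_prop) (by fun_prop)) fun t => ?_
  rw [← map_add, ← ofPre_star, ← ofPre_star, ← ofPre_star, ← map_add, star_add]

instance : StarRing (MinTensor A B) where
  star_involutive := MinTensor.star_star'
  star_mul := MinTensor.star_mul'
  star_add := MinTensor.star_add'

instance : CStarRing (MinTensor A B) where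
  norm_mul_self_le a := by
    refine induction_on a (isClosed_le (by fun_prop) (by fun_prop)) fun s => ?_
    rw [← ofPre_star, ← ofPre_mul, LinearIsometry.norm_map, LinearIsometry.norm_map]
    exact minNorm_mul_self_le (A := A) (B := B) s

instance : IsScalarTower ℂ (MinTensor A B) (MinTensor A B) := ⟨MinTensor.smul_mul'⟩

instance : SMulCommClass ℂ (MinTensor A B) (MinTensor A B) :=
  ⟨fun c a b => (MinTensor.mul_smul' c a b).symm⟩

instance : StarModule ℂ (MinTensor A B) := ⟨MinTensor.star_smul'⟩

/-- The minimal tensor product is a C⋆-algebra. -/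
instance : NonUnitalCStarAlgebra (MinTensor A B) where

/-- The elementary tensor `a ⊗ b` in the minimal tensor product. -/
def tmul (a : A) (b : B) : MinTensor A B := ofPre A B (a ⊗ₜ[ℂ] b : A ⊗[ℂ] B)

/-- The (algebraic) tensor product `S ⊗ T` of two subspaces, inside the minimal tensor product:
the linear span of the elementary tensors `a ⊗ b` with `a ∈ S` and `b ∈ T`. -/
def subspaceTensor (S : Submodule ℂ A) (T : Submodule ℂ B) : Submodule ℂ (MinTensor A B) :=
  Submodule.span ℂ {x | ∃ a ∈ S, ∃ b ∈ T, x = tmul a b}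

end MinTensor

end CStarTensor

section Ideals

/-- A closed two-sided ideal: a norm-closed subspace that absorbs products on both sides. -/
structure IsClosedIdeal {M : Type*} [NonUnitalCStarAlgebra M] (I : Submodule ℂ M) : Prop where
  isClosed : IsClosed (I : Set M)
  mul_mem_left : ∀ a : M, ∀ x ∈ I, a * x ∈ I
  mul_mem_right : ∀ a : M, ∀ x ∈ I, x * a ∈ I

/-- A C⋆-algebra is simple if it is nonzero and its only closed two-sided ideals are zero and the
whole algebra. -/
structure IsSimpleCStarAlgebra (M : Type*) [NonUnitalCStarAlgebra M] : Prop where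
  nontrivial : Nontrivial M
  eq_bot_or_eq_top : ∀ I : Submodule ℂ M, IsClosedIdeal I → I = ⊥ ∨ I = ⊤

/-- `e` is a unit (two-sided multiplicative identity) of `M`. -/
def IsUnitElement {M : Type*} [NonUnitalCStarAlgebra M] (e : M) : Prop :=
  ∀ a : M, e * a = a ∧ a * e = a

/-- The Lie normalizer `N(S)` of a subspace `S`: all `a` with `[a, M] ⊆ S`. -/
def lieNormalizer {M : Type*} [NonUnitalCStarAlgebra M] (S : Submodule ℂ M) : Submodule ℂ M where
  carrier := {a | ∀ b : M, a * b - b * a ∈ S}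
  zero_mem' b := by simp
  add_mem' {x y} hx hy b := by
    have h : (x + y) * b - b * (x + y) = (x * b - b * x) + (y * b - b * y) := by
      rw [add_mul, mul_add]; abel
    rw [h]
    exact S.add_mem (hx b) (hy b)
  smul_mem' c x hx b := by
    have h : (c • x) * b - b * (c • x) = c • (x * b - b * x) := by
      rw [smul_mul_assoc, mul_smul_comm, smul_sub]
    rw [h]
    exact S.smul_mem c (hx b)

end Ideals

end

/-! For simple `A`, the algebra `A ⊗ C₀(X)` sits isometrically inside `C₀(X, A)` through `a ⊗ f ↦ (x
↦ f x • a)`; surjectivity of this embedding is never needed. That the supremum norm is at most the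
minimal norm comes from pairing an isometric representation of `A` with point evaluations
(`norm_toFunctions_le`). The reverse bound (`norm_rep_le_norm_toFunctions`) is local: near a point,
a tensor acts in any `π ⊗ σ` almost like its constant value there, and
`IsSelfAdjoint.norm_le_of_local` glues such bounds without loss.

In the function picture a closed ideal `I` is determined by its zero set `Z`. Away from `Z` the
values of `I` generate a nonzero ideal of `A`, which is dense by simplicity, and a partition of
unity then approximates by members of `I` every element that vanishes on `Z`
(`FunctionModel.mem_of_vanishing`).

If all commutators of `m` lie in `I`, they vanish on `Z`, so `m x` is central in `A` for every `x ∈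
Z`. The center of a simple algebra is `ℂ e` if there is a unit `e`, and zero otherwise
(`IsSimpleCStarAlgebra.exists_eq_smul_unit`, `IsSimpleCStarAlgebra.exists_unit_of_central`). Without
a unit, `m` vanishes on `Z` and lies in `I`. With a unit, `m` agrees on `Z` with `e ⊗ f`, where `f =
φ ∘ m` for a functional `φ` with `φ e = 1`; hence `m - e ⊗ f ∈ I`. Conversely, each `e ⊗ f` is
central. -/

open scoped TensorProduct ZeroAtInfty

noncomputable section

/-! ### The center of a simple C⋆-algebra. -/

section Center

variable {A : Type u} [NonUnitalCStarAlgebra A]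

lemma IsUnitElement.eq {e f : A} (he : IsUnitElement e) (hf : IsUnitElement f) : e = f := by
  rw [← (hf e).1, (he f).2]

/-- In a simple C⋆-algebra, nonzero central elements are not zero divisors. -/
lemma IsSimpleCStarAlgebra.eq_zero_of_central_mul (hA : IsSimpleCStarAlgebra A) {z a : A}
    (hz : ∀ b, Commute z b) (hz0 : z ≠ 0) (h : z * a = 0) : a = 0 := by
  let J : Submodule ℂ A := LinearMap.ker (LinearMap.mulLeft ℂ z)
  have hmem : ∀ b, b ∈ J ↔ z * b = 0 := fun b => by simp [J]
  have hJ : IsClosedIdeal J := by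
    refine ⟨?_, fun b x hx => ?_, fun b x hx => ?_⟩
    · have : (J : Set A) = (fun b => z * b) ⁻¹' {0} := by ext b; exact hmem b
      rw [this]
      exact isClosed_singleton.preimage (by fun_prop)
    · rw [hmem] at *
      rw [← mul_assoc, (hz b).eq, mul_assoc, hx, mul_zero]
    · rw [hmem] at *
      rw [← mul_assoc, hx, zero_mul]
  rcases hA.eq_bot_or_eq_top J hJ with h' | h'
  · have := (hmem a).2 h
    rwa [h', Submodule.mem_bot] at this
  -- If `z` annihilates everything, then `z * star z = 0`, and the C⋆-identity gives `z = 0`.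
  · have : star z ∈ J := h' ▸ Submodule.mem_top
    rw [hmem, CStarRing.mul_star_self_eq_zero_iff] at this
    exact absurd this hz0

/-- A central selfadjoint element of a simple C⋆-algebra is a multiple of a projection. -/
lemma IsSimpleCStarAlgebra.exists_mul_self_eq_smul (hA : IsSimpleCStarAlgebra A) {p : A}
    (hp : ∀ b, Commute p b) (hs : IsSelfAdjoint p) : ∃ t : ℝ, p * p = t • p := by
  have key : ∀ t₁ ∈ quasispectrum ℝ p, ∀ t₂ ∈ quasispectrum ℝ p, t₁ ≠ 0 → t₂ ≠ 0 →
      ¬ t₁ < t₂ := by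
    intro t₁ h₁ t₂ h₂ h₁' h₂' hlt
    -- Two distinct nonzero spectral values would give nonzero central elements `f(p)` and `g(p)`
    -- with product zero, since `f` and `g` live on opposite sides of the midpoint. The factor `x`
    -- makes both vanish at `0`, as the non-unital functional calculus requires.
    set s := (t₁ + t₂) / 2 with hs'
    let f : ℝ → ℝ := fun x => x * max (x - s) 0
    let g : ℝ → ℝ := fun x => x * max (s - x) 0
    have hf : Continuous f := by fun_prop
    have hg : Continuous g := by fun_prop
    have hne : ∀ k : ℝ → ℝ, Continuous k → k 0 = 0 → ∀ t ∈ quasispectrum ℝ p, k t ≠ 0 →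
        cfcₙ k p ≠ 0 := by
      intro k hk hk0 t ht hkt h0
      have := norm_apply_le_norm_cfcₙ k p ht hk.continuousOn hk0 hs
      rw [h0, norm_zero] at this
      exact hkt (norm_le_zero_iff.1 this)
    refine hne g hg (by simp [g]) t₁ h₁ (mul_ne_zero h₁' ?_) ?_
    · rw [max_eq_left (by linarith)]; linarith
    refine hA.eq_zero_of_central_mul (z := cfcₙ f p) (fun b => (hp b).cfcₙ_real f)
      (hne f hf (by simp [f]) t₂ h₂ (mul_ne_zero h₂' ?_)) ?_
    · rw [max_eq_left (by linarith)]; linarith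
    · rw [← cfcₙ_mul f g p hf.continuousOn (by simp [f]) hg.continuousOn (by simp [g])]
      have : (fun x => f x * g x) = fun _ => 0 := by
        funext x
        simp only [f, g]
        rcases le_total x s with h | h
        · rw [max_eq_right (by linarith)]; ring
        · rw [max_eq_right (a := s - x) (by linarith)]; ring
      rw [this, cfcₙ_const_zero]
  obtain ⟨t, ht⟩ : ∃ t : ℝ, ∀ x ∈ quasispectrum ℝ p, x = 0 ∨ x = t := by
    by_cases h : ∃ t ∈ quasispectrum ℝ p, t ≠ 0
    · obtain ⟨t, ht, ht0⟩ := h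
      refine ⟨t, fun x hx => or_iff_not_imp_left.2 fun hx0 => ?_⟩
      exact le_antisymm (not_lt.1 (key t ht x hx ht0 hx0)) (not_lt.1 (key x hx t ht hx0 ht0))
    · push Not at h
      exact ⟨0, fun x hx => Or.inl (h x hx)⟩
  refine ⟨t, ?_⟩
  have h1 : cfcₙ (fun x : ℝ => x * x) p = p * p := by
    rw [cfcₙ_mul (fun x : ℝ => x) (fun x => x) p, cfcₙ_id' ℝ p]
  have h2 : cfcₙ (fun x : ℝ => t • x) p = t • p := by
    rw [cfcₙ_smul t (fun x : ℝ => x) p, cfcₙ_id' ℝ p]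
  -- The functions `x * x` and `t * x` agree at `0` and at `t`, hence on the whole quasispectrum.
  rw [← h1, ← h2]
  refine cfcₙ_congr fun x hx => ?_
  rcases ht x hx with rfl | rfl <;> simp

/-- From `p * p = t • p` one gets `p * (p * a - t • a) = 0` for all `a`, and cancelling the central
`p` shows that `p` acts as the scalar `t`. Here `t ≠ 0`, as otherwise `p * p = 0`; so `t⁻¹ • p` is a
unit. -/
lemma IsSimpleCStarAlgebra.exists_unit_of_selfAdjoint (hA : IsSimpleCStarAlgebra A) {p : A}
    (hp : ∀ b, Commute p b) (hs : IsSelfAdjoint p) (hp0 : p ≠ 0) :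
    ∃ e : A, IsUnitElement e ∧ ∃ t : ℂ, p = t • e := by
  obtain ⟨t, ht⟩ := hA.exists_mul_self_eq_smul hp hs
  have ht0 : t ≠ 0 := by
    rintro rfl
    rw [zero_smul] at ht
    exact hp0 (hA.eq_zero_of_central_mul hp hp0 ht)
  have hpa : ∀ a, p * a = t • a := fun a => by
    rw [← sub_eq_zero]
    refine hA.eq_zero_of_central_mul hp hp0 ?_
    rw [mul_sub, ← mul_assoc, ht, smul_mul_assoc, mul_smul_comm, sub_self]
  refine ⟨t⁻¹ • p, fun a => ⟨?_, ?_⟩, (t : ℂ), ?_⟩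
  · rw [smul_mul_assoc, hpa, inv_smul_smul₀ ht0]
  · rw [mul_smul_comm, ← (hp a).eq, hpa, inv_smul_smul₀ ht0]
  · rw [Complex.coe_smul, smul_inv_smul₀ ht0]

/-- The center is stable under `star`; this reduces questions about central elements to selfadjoint
ones. -/
lemma central_realPart_imaginaryPart {z : A} (hz : ∀ b, Commute z b) (b : A) :
    Commute (realPart z : A) b ∧ Commute (imaginaryPart z : A) b := by
  have hz' : star z * b = b * star z := by
    simpa using (congrArg star (hz (star b)).eq).symm
  rw [realPart_apply_coe, imaginaryPart_apply_coe]
  replace hz' : Commute (star z) b := hz'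
  exact ⟨((hz b).add_left hz').smul_left _, (((hz b).sub_left hz').smul_left _).smul_left _⟩

/-- A simple C⋆-algebra with a nonzero central element is unital. -/
lemma IsSimpleCStarAlgebra.exists_unit_of_central (hA : IsSimpleCStarAlgebra A) {z : A}
    (hz : ∀ b, Commute z b) (hz0 : z ≠ 0) : ∃ e : A, IsUnitElement e := by
  by_contra h
  have h' : ∀ p : A, (∀ b, Commute p b) → IsSelfAdjoint p → p = 0 := fun p hp hs => by
    by_contra hp0
    obtain ⟨e, he, -⟩ := hA.exists_unit_of_selfAdjoint hp hs hp0
    exact h ⟨e, he⟩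
  apply hz0
  rw [← realPart_add_I_smul_imaginaryPart z,
    h' _ (fun b => (central_realPart_imaginaryPart hz b).1) (realPart z).2,
    h' _ (fun b => (central_realPart_imaginaryPart hz b).2) (imaginaryPart z).2, smul_zero, add_zero]

/-- The center of a unital simple C⋆-algebra consists of the multiples of the unit. -/
lemma IsSimpleCStarAlgebra.exists_eq_smul_unit (hA : IsSimpleCStarAlgebra A) {e z : A}
    (he : IsUnitElement e) (hz : ∀ b, Commute z b) : ∃ c : ℂ, z = c • e := by
  have h' : ∀ p : A, (∀ b, Commute p b) → IsSelfAdjoint p → ∃ c : ℂ, p = c • e := by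
    intro p hp hs
    by_cases hp0 : p = 0
    · exact ⟨0, by rw [hp0, zero_smul]⟩
    · obtain ⟨f, hf, t, ht⟩ := hA.exists_unit_of_selfAdjoint hp hs hp0
      exact ⟨t, by rw [ht, he.eq hf]⟩
  obtain ⟨c, hc⟩ := h' _ (fun b => (central_realPart_imaginaryPart hz b).1) (realPart z).2
  obtain ⟨d, hd⟩ := h' _ (fun b => (central_realPart_imaginaryPart hz b).2) (imaginaryPart z).2
  refine ⟨c + Complex.I * d, ?_⟩
  rw [add_smul, mul_smul, ← hc, ← hd, realPart_add_I_smul_imaginaryPart]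

end Center

/-! ### States, the GNS construction and isometric representations. -/

section Representation

/-- A norm-one functional on a unital C⋆-algebra that takes the value one at the unit is real on
selfadjoint elements. -/
lemma im_eq_zero_of_norm_le_one {B : Type*} [CStarAlgebra B] [Nontrivial B] {g : StrongDual ℂ B}
    (hg : ‖g‖ ≤ 1) (hg1 : g 1 = 1) {a : B} (ha : IsSelfAdjoint a) : (g a).im = 0 := by
  -- Shift `a` by the imaginary scalar `i t`: the squared norm grows by at most `t ^ 2`, whereas a
  -- nonzero imaginary part of `g a` would contribute a term linear in `t`.
  have key : ∀ t : ℝ, ((g a).im + t) ^ 2 ≤ ‖a‖ ^ 2 + t ^ 2 := by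
    intro t
    have h1 : ‖g (a + (Complex.I * t) • (1 : B))‖ ≤ ‖a + (Complex.I * t) • (1 : B)‖ :=
      (g.le_opNorm _).trans (mul_le_of_le_one_left (norm_nonneg _) hg)
    have h2 : ‖a + (Complex.I * t) • (1 : B)‖ ^ 2 ≤ ‖a‖ ^ 2 + t ^ 2 := by
      rw [sq, ← CStarRing.norm_star_mul_self]
      have : star (a + (Complex.I * t) • (1 : B)) * (a + (Complex.I * t) • (1 : B))
          = a * a + ((t : ℂ) ^ 2) • (1 : B) := by
        rw [star_add, star_smul, star_one, ha.star_eq]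
        have : star (Complex.I * (t : ℂ)) = -(Complex.I * t) := by simp
        rw [this]
        have h3 : -(Complex.I * (t : ℂ)) * (Complex.I * t) = (t : ℂ) ^ 2 := by
          linear_combination (-(t : ℂ) ^ 2) * Complex.I_sq
        simp only [add_mul, mul_add, smul_mul_assoc, mul_smul_comm, one_mul, mul_one, smul_add,
          smul_smul, mul_comm (Complex.I * (t : ℂ)) (-(Complex.I * t)), h3]
        rw [neg_smul]
        abel
      rw [this]
      refine (norm_add_le _ _).trans (add_le_add ((norm_mul_le _ _).trans (sq _).ge) ?_)
      refine (norm_smul_le _ _).trans ?_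
      simp only [CStarRing.norm_one, mul_one, norm_pow, Complex.norm_real, Real.norm_eq_abs,
        sq_abs, le_refl]
    have h3 : ((g a).im + t) ^ 2 ≤ ‖g (a + (Complex.I * t) • (1 : B))‖ ^ 2 := by
      rw [map_add, map_smul, hg1, ← Complex.normSq_eq_norm_sq, Complex.normSq_apply]
      simp
      nlinarith [sq_nonneg (g a).re]
    exact h3.trans ((pow_le_pow_left₀ (norm_nonneg _) h1 2).trans h2)
  by_contra h
  -- This `t` makes the cross term `2 * (g a).im * t` equal to `‖a‖ ^ 2 + 1`, which is too large.
  have := key ((‖a‖ ^ 2 + 1) / (2 * (g a).im))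
  have h5 : 2 * (g a).im * ((‖a‖ ^ 2 + 1) / (2 * (g a).im)) = ‖a‖ ^ 2 + 1 := by
    field_simp
  nlinarith [sq_nonneg (g a).im]

open scoped CStarAlgebra ComplexOrder in
/-- A norm-one functional on a unital C⋆-algebra that takes the value one at the unit is
positive. -/
lemma nonneg_of_norm_le_one {B : Type*} [CStarAlgebra B] [PartialOrder B] [StarOrderedRing B]
    [Nontrivial B] {g : StrongDual ℂ B}
    (hg : ‖g‖ ≤ 1) (hg1 : g 1 = 1) {a : B} (ha : 0 ≤ a) : 0 ≤ g a := by
  have him := im_eq_zero_of_norm_le_one hg hg1 (IsSelfAdjoint.of_nonneg ha)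
  rw [Complex.nonneg_iff]
  refine ⟨?_, him.symm⟩
  have h1 : ‖algebraMap ℝ B ‖a‖ - a‖ ≤ ‖a‖ := by
    have h0 : 0 ≤ algebraMap ℝ B ‖a‖ - a :=
      sub_nonneg.2 (IsSelfAdjoint.of_nonneg ha).le_algebraMap_norm_self
    rw [CStarAlgebra.norm_le_iff_le_algebraMap _ (norm_nonneg a) h0]
    simpa using ha
  have h2 : ‖g (algebraMap ℝ B ‖a‖ - a)‖ ≤ ‖a‖ :=
    ((g.le_opNorm _).trans (mul_le_of_le_one_left (norm_nonneg _) hg)).trans h1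
  have h3 : g (algebraMap ℝ B ‖a‖ - a) = ‖a‖ - g a := by
    rw [map_sub, Algebra.algebraMap_eq_smul_one, ← Complex.coe_smul, map_smul, hg1]; simp
  rw [h3] at h2
  have h4 := (Complex.re_le_norm _).trans h2
  simp at h4
  exact h4

/-- For every positive element of a unital C⋆-algebra there is a state attaining its norm. -/
lemma exists_state {B : Type*} [CStarAlgebra B] [PartialOrder B] [StarOrderedRing B] [Nontrivial B]
    {p : B} (hp : 0 ≤ p) : ∃ g : StrongDual ℂ B, ‖g‖ ≤ 1 ∧ g 1 = 1 ∧ g p = ‖p‖ := by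
  have hnorm : 1 + ‖p‖ ≤ ‖1 + p‖ := by
    have h1 : (1 + ‖p‖ : ℝ) ∈ spectrum ℝ (algebraMap ℝ B 1 + p) :=
      by
      rw [add_comm (1 : ℝ)]
      exact spectrum.add_mem_add_iff.2 (CStarAlgebra.norm_mem_spectrum_of_nonneg hp)
    rw [map_one] at h1
    have := spectrum.norm_le_norm_of_mem h1
    rwa [Real.norm_of_nonneg (by positivity)] at this
  obtain ⟨g, hg, hgp⟩ := exists_dual_vector'' ℂ (1 + p)
  have h1 : ‖g 1‖ ≤ 1 := by
    simpa using (g.le_opNorm _).trans (mul_le_of_le_one_left (norm_nonneg (1 : B)) hg)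
  have h2 : ‖g p‖ ≤ ‖p‖ := (g.le_opNorm _).trans (mul_le_of_le_one_left (norm_nonneg p) hg)
  have h3 := congrArg Complex.re hgp
  simp only [map_add, Complex.add_re] at h3
  -- The two real parts add up to `‖1 + p‖ ≥ 1 + ‖p‖`, while they are at most `1` and `‖p‖`; so
  -- equality holds throughout.
  have h4 : (g 1).re = ‖g 1‖ ∧ (g p).re = ‖g p‖ ∧ ‖g 1‖ = 1 ∧ ‖g p‖ = ‖p‖ := by
    have := Complex.re_le_norm (g 1)
    have := Complex.re_le_norm (g p)
    have : (((‖1 + p‖ : ℝ) : ℂ)).re = ‖1 + p‖ := Complex.ofReal_re _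
    refine ⟨?_, ?_, ?_, ?_⟩ <;> simp at h3 <;> linarith
  have h5 : ∀ w : ℂ, w.re = ‖w‖ → w = ‖w‖ := fun w hw =>
    (Complex.eq_coe_norm_of_nonneg (Complex.re_eq_norm.1 hw))
  refine ⟨g, hg, ?_, ?_⟩
  · rw [h5 _ h4.1, h4.2.2.1, Complex.ofReal_one]
  · rw [h5 _ h4.2.1, h4.2.2.2]

open scoped CStarAlgebra ComplexOrder in
/-- Every nonzero C⋆-algebra has a nonzero representation on a Hilbert space. -/
lemma exists_nonzero_representation (A : Type u) [NonUnitalCStarAlgebra A] [Nontrivial A] :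
    ∃ (H : Type u) (_ : NormedAddCommGroup H) (_ : InnerProductSpace ℂ H) (_ : CompleteSpace H)
      (π : A →⋆ₙₐ[ℂ] (H →L[ℂ] H)), π ≠ 0 := by
  let _ : PartialOrder A := CStarAlgebra.spectralOrder A
  have _ : StarOrderedRing A := CStarAlgebra.spectralOrderedRing A
  obtain ⟨x, hx⟩ := exists_ne (0 : A)
  -- With `p = star c * c`, the number `f p` is the squared GNS norm of `star x` acting on the class
  -- of `x`. This exhibits a nonzero operator without any cyclic vector.
  let c := star x * x
  let p := star c * c
  have hp0 : p ≠ 0 := by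
    simp only [p, c, ne_eq, CStarRing.star_mul_self_eq_zero_iff]
    exact hx
  obtain ⟨g, hg, hg1, hgp⟩ := exists_state (B := Unitization ℂ A) (p := (p : Unitization ℂ A))
    (Unitization.inr_nonneg_iff.2 (star_mul_self_nonneg c))
  let f : A →ₚ[ℂ] ℂ := PositiveLinearMap.mk₀ (g.toLinearMap ∘ₗ Unitization.inrHom ℂ ℂ A)
    fun a ha => nonneg_of_norm_le_one hg hg1 (Unitization.inr_nonneg_iff.2 ha)
  have hfp : f p ≠ 0 := by
    change g (p : Unitization ℂ A) ≠ 0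
    rw [hgp, Unitization.norm_inr]
    simpa using hp0
  refine ⟨f.GNS, inferInstance, inferInstance, inferInstance, f.gnsNonUnitalStarAlgHom, ?_⟩
  intro h0
  have h1 : f.gnsNonUnitalStarAlgHom (star x) ((f.toPreGNS x : f.PreGNS) : f.GNS) = 0 := by
    rw [h0]; rfl
  rw [PositiveLinearMap.gnsNonUnitalStarAlgHom_apply_coe] at h1
  have h2 := congrArg norm h1
  rw [UniformSpace.Completion.norm_coe, norm_zero] at h2
  have h3 := f.preGNS_norm_sq (f.leftMulMapPreGNS (star x) (f.toPreGNS x))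
  rw [h2] at h3
  apply hfp
  simpa [p, c] using h3.symm

/-- A simple C⋆-algebra has an isometric representation on a Hilbert space. -/
lemma IsSimpleCStarAlgebra.exists_isometric_representation {A : Type u} [NonUnitalCStarAlgebra A]
    (hA : IsSimpleCStarAlgebra A) :
    ∃ (H : Type u) (_ : NormedAddCommGroup H) (_ : InnerProductSpace ℂ H) (_ : CompleteSpace H)
      (π : A →⋆ₙₐ[ℂ] (H →L[ℂ] H)), ∀ a, ‖π a‖ = ‖a‖ := by
  have := hA.nontrivial
  obtain ⟨H, i₁, i₂, i₃, π, hπ⟩ := exists_nonzero_representation A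
  refine ⟨H, i₁, i₂, i₃, π, ?_⟩
  -- The kernel is a closed ideal and is proper because `π ≠ 0`; so `π` is injective, and an
  -- injective `*`-homomorphism is isometric.
  let J : Submodule ℂ A := LinearMap.ker (π : A →ₗ[ℂ] (H →L[ℂ] H))
  have hmem : ∀ b, b ∈ J ↔ π b = 0 := fun b => Iff.rfl
  have hJ : IsClosedIdeal J := by
    refine ⟨?_, fun b x hx => ?_, fun b x hx => ?_⟩
    · have : (J : Set A) = π ⁻¹' {0} := by ext b; exact hmem b
      rw [this]
      exact isClosed_singleton.preimage (AddMonoidHomClass.continuous_of_bound π 1 fun a => by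
        simpa using NonUnitalStarAlgHom.norm_apply_le π a)
    · rw [hmem] at *
      rw [map_mul, hx, mul_zero]
    · rw [hmem] at *
      rw [map_mul, hx, zero_mul]
  rcases hA.eq_bot_or_eq_top J hJ with h | h
  · exact NonUnitalStarAlgHom.norm_map π
      ((injective_iff_map_eq_zero π).2 fun a ha => by
        rwa [← hmem, h, Submodule.mem_bot] at ha)
  · refine absurd (NonUnitalStarAlgHom.ext fun a => ?_) hπ
    exact (hmem a).1 (h ▸ Submodule.mem_top)

end Representation

/-! ### Gluing local norm bounds. -/

/-- If a selfadjoint `S` is decomposed as `∑ G j * S` and every `‖G' j * S‖` is at most `c`, where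
the `G j = G j * G' j` are contractions and `G' j` commutes with `S`, then `‖S‖ ≤ c`. -/
lemma IsSelfAdjoint.norm_le_of_local {B : Type*} [CStarAlgebra B] {S : B} (hS : IsSelfAdjoint S)
    {n : ℕ} {G G' : Fin n → B} {c : ℝ} (hG : ∀ j, ‖G j‖ ≤ 1) (hGG' : ∀ j, G j * G' j = G j)
    (hcomm : ∀ j, Commute (G' j) S) (hsum : ∑ j, G j * S = S) (hc : ∀ j, ‖G' j * S‖ ≤ c)
    (hc0 : 0 ≤ c) : ‖S‖ ≤ c := by
  have hGk : ∀ j (k : ℕ), G j * G' j ^ k = G j := fun j k => by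
    induction k with
    | zero => rw [pow_zero, mul_one]
    | succ k ih => rw [pow_succ, ← mul_assoc, ih, hGG']
  -- The triangle inequality on `S` itself would lose a factor `n`. Since `G j` absorbs powers of
  -- `G' j`, the same loss `n` occurs for every power of `S`, and it disappears on taking roots.
  have hpow : ∀ k : ℕ, ‖S ^ (k + 1)‖ ≤ n * c ^ (k + 1) := fun k => by
    have : S ^ (k + 1) = ∑ j, G j * (G' j * S) ^ (k + 1) := by
      calc S ^ (k + 1) = (∑ j, G j * S) * S ^ k := by rw [hsum, pow_succ']
        _ = ∑ j, G j * (G' j * S) ^ (k + 1) := by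
          rw [Finset.sum_mul]
          refine Finset.sum_congr rfl fun j _ => ?_
          rw [(hcomm j).mul_pow, ← mul_assoc, hGk, mul_assoc, ← pow_succ']
    rw [this]
    refine (norm_sum_le_of_le _ fun j _ => ?_).trans (by simp : ∑ _ : Fin n, c ^ (k + 1) ≤ _)
    refine (norm_mul_le _ _).trans ((mul_le_of_le_one_left (norm_nonneg _) (hG j)).trans ?_)
    exact (norm_pow_le' _ k.succ_pos).trans (pow_le_pow_left₀ (norm_nonneg _) (hc j) _)
  by_contra! h
  have hS0 : 0 < ‖S‖ := hc0.trans_lt h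
  have hr : c / ‖S‖ < 1 := (div_lt_one hS0).2 h
  have hr0 : 0 ≤ c / ‖S‖ := by positivity
  -- Powers `2 ^ m` are used because `‖S ^ 2 ^ m‖ = ‖S‖ ^ 2 ^ m` for selfadjoint `S`. It suffices to
  -- make `n * (c / ‖S‖) ^ m` smaller than `1`, as `m < 2 ^ m`.
  obtain ⟨m, hm⟩ := ((tendsto_pow_atTop_nhds_zero_of_lt_one hr0 hr).const_mul (n : ℝ)
    |>.eventually_lt_const (by simp : (n : ℝ) * 0 < 1)).exists
  obtain ⟨k, hk⟩ : ∃ k, 2 ^ m = k + 1 := ⟨2 ^ m - 1, by have := Nat.one_le_two_pow (n := m); omega⟩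
  have h1 := hpow k
  rw [← hk, hS.norm_pow_two_pow] at h1
  have h2 : (1 : ℝ) ≤ n * (c / ‖S‖) ^ (2 ^ m) := by
    rw [div_pow, ← mul_div_assoc, le_div_iff₀ (by positivity), one_mul]
    exact h1
  have h3 : (c / ‖S‖) ^ (2 ^ m) ≤ (c / ‖S‖) ^ m :=
    pow_le_pow_of_le_one hr0 hr.le Nat.lt_two_pow_self.le
  exact absurd (h2.trans (mul_le_mul_of_nonneg_left h3 n.cast_nonneg)) (not_le.2 hm)

/-! ### Elementary functions vanishing at infinity. -/

namespace ZeroAtInftyContinuousMap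

variable {X : Type v} [TopologicalSpace X]

lemma norm_apply_le {E : Type*} [NormedAddCommGroup E] (f : C₀(X, E)) (x : X) : ‖f x‖ ≤ ‖f‖ :=
  f.toBCF.norm_coe_le_norm x

lemma norm_le {E : Type*} [NormedAddCommGroup E] {f : C₀(X, E)} {c : ℝ} (hc : 0 ≤ c)
    (h : ∀ x, ‖f x‖ ≤ c) : ‖f‖ ≤ c :=
  (BoundedContinuousFunction.norm_le (f := f.toBCF) hc).2 h

/-- A compactly supported real function, as a complex function vanishing at infinity. -/
def ofRealCompactSupport (f : C(X, ℝ)) (hf : HasCompactSupport f) : C₀(X, ℂ) where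
  toFun x := (f x : ℂ)
  continuous_toFun := by fun_prop
  zero_at_infty' := by
    have := (Complex.continuous_ofReal.tendsto 0).comp hf.is_zero_at_infty
    rwa [Complex.ofReal_zero] at this

@[simp] lemma ofRealCompactSupport_apply (f : C(X, ℝ)) (hf : HasCompactSupport f) (x : X) :
    ofRealCompactSupport f hf x = f x := rfl

lemma norm_ofRealCompactSupport_le {f : C(X, ℝ)} (hf : HasCompactSupport f)
    (h : ∀ x, f x ∈ Set.Icc (0 : ℝ) 1) : ‖ofRealCompactSupport f hf‖ ≤ 1 :=
  norm_le zero_le_one fun x => by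
    rw [ofRealCompactSupport_apply, Complex.norm_real, Real.norm_of_nonneg (h x).1]
    exact (h x).2

lemma star_ofRealCompactSupport (f : C(X, ℝ)) (hf : HasCompactSupport f) :
    star (ofRealCompactSupport f hf) = ofRealCompactSupport f hf := by
  ext x; simp

/-- The function `x ↦ f x • a`. -/
def smulConst {A : Type u} [NonUnitalCStarAlgebra A] (a : A) (f : C₀(X, ℂ)) : C₀(X, A) where
  toFun x := f x • a
  continuous_toFun := by fun_prop
  zero_at_infty' := by
    simpa using (zero_at_infty f).smul_const a

@[simp] lemma smulConst_apply {A : Type u} [NonUnitalCStarAlgebra A] (a : A) (f : C₀(X, ℂ))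
    (x : X) : smulConst a f x = f x • a := rfl

end ZeroAtInftyContinuousMap

open ZeroAtInftyContinuousMap

/-! ### Tensors as `A`-valued functions, and their local behavior in representations. -/

namespace CStarTensor

namespace PreMin

variable {A : Type u} {B : Type v} [NonUnitalCStarAlgebra A] [NonUnitalCStarAlgebra B]

/-- The elementary tensor `a ⊗ b`. -/
def tmul (a : A) (b : B) : PreMin A B := (a ⊗ₜ[ℂ] b : A ⊗[ℂ] B)

@[elab_as_elim]
lemma induction_on {p : PreMin A B → Prop} (t : PreMin A B) (zero : p 0)
    (tmul : ∀ a b, p (tmul a b)) (add : ∀ s t, p s → p t → p (s + t)) : p t :=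
  TensorProduct.induction_on (motive := p) t zero tmul add

lemma tmul_mul_tmul (a a' : A) (b b' : B) :
    tmul a b * tmul a' b' = tmul (a * a') (b * b') :=
  Algebra.TensorProduct.tmul_mul_tmul a a' b b'

lemma star_tmul (a : A) (b : B) : star (tmul a b) = tmul (star a) (star b) :=
  TensorProduct.star_tmul a b

/-- The linear map on `A ⊗ B` induced by a bilinear map. -/
def lift {E : Type*} [AddCommGroup E] [Module ℂ E] (f : A →ₗ[ℂ] B →ₗ[ℂ] E) : PreMin A B →ₗ[ℂ] E :=
  TensorProduct.lift f

variable {H : Type u} [NormedAddCommGroup H] [InnerProductSpace ℂ H] [CompleteSpace H]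
variable {K : Type v} [NormedAddCommGroup K] [InnerProductSpace ℂ K] [CompleteSpace K]

/-- The representation `π ⊗ σ` of `A ⊗ B`. -/
def rep (π : A →⋆ₙₐ[ℂ] (H →L[ℂ] H)) (σ : B →⋆ₙₐ[ℂ] (K →L[ℂ] K)) :
    PreMin A B →ₗ[ℂ] (HilbertTensor H K →L[ℂ] HilbertTensor H K) :=
  repTensor π σ

lemma rep_tmul (π : A →⋆ₙₐ[ℂ] (H →L[ℂ] H)) (σ : B →⋆ₙₐ[ℂ] (K →L[ℂ] K)) (a : A) (b : B) :
    rep π σ (tmul a b) = opTensor (π a) (σ b) := rfl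

lemma rep_mul (π : A →⋆ₙₐ[ℂ] (H →L[ℂ] H)) (σ : B →⋆ₙₐ[ℂ] (K →L[ℂ] K)) (s t : PreMin A B) :
    rep π σ (s * t) = rep π σ s * rep π σ t := repTensor_mul π σ s t

lemma rep_star (π : A →⋆ₙₐ[ℂ] (H →L[ℂ] H)) (σ : B →⋆ₙₐ[ℂ] (K →L[ℂ] K)) (t : PreMin A B) :
    rep π σ (star t) = star (rep π σ t) := repTensor_star π σ t

lemma norm_rep_le (π : A →⋆ₙₐ[ℂ] (H →L[ℂ] H)) (σ : B →⋆ₙₐ[ℂ] (K →L[ℂ] K)) (t : PreMin A B) :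
    ‖rep π σ t‖ ≤ ‖t‖ := norm_repTensor_le_minNorm π σ t

lemma norm_le {t : PreMin A B} {c : ℝ}
    (h : ∀ (H : Type u) [NormedAddCommGroup H] [InnerProductSpace ℂ H] [CompleteSpace H]
      (K : Type v) [NormedAddCommGroup K] [InnerProductSpace ℂ K] [CompleteSpace K]
      (π : A →⋆ₙₐ[ℂ] (H →L[ℂ] H)) (σ : B →⋆ₙₐ[ℂ] (K →L[ℂ] K)), ‖rep π σ t‖ ≤ c) :
    ‖t‖ ≤ c := minNorm_le h

end PreMin

section Functions

variable {A : Type u} [NonUnitalCStarAlgebra A] {X : Type v} [TopologicalSpace X]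

/-- The map from `A ⊗ C₀(X)` to `C₀(X, A)` with `a ⊗ f ↦ f • a`. -/
def toFunctions (A : Type u) [NonUnitalCStarAlgebra A] (X : Type v) [TopologicalSpace X] :
    PreMin A C₀(X, ℂ) →ₗ[ℂ] C₀(X, A) :=
  PreMin.lift (LinearMap.mk₂ ℂ smulConst
    (fun a a' f => ZeroAtInftyContinuousMap.ext fun x => smul_add (f x) a a')
    (fun c a f => ZeroAtInftyContinuousMap.ext fun x => smul_comm (f x) c a)
    (fun a f f' => ZeroAtInftyContinuousMap.ext fun x => add_smul (f x) (f' x) a)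
    (fun c a f => ZeroAtInftyContinuousMap.ext fun x => mul_smul c (f x) a))

@[simp] lemma toFunctions_tmul (a : A) (f : C₀(X, ℂ)) :
    toFunctions A X (PreMin.tmul a f) = smulConst a f := rfl

lemma toFunctions_mul (s t : PreMin A C₀(X, ℂ)) :
    toFunctions A X (s * t) = toFunctions A X s * toFunctions A X t := by
  induction s using PreMin.induction_on with
  | zero => rw [zero_mul, map_zero, zero_mul]
  | add x y hx hy => rw [add_mul, map_add, map_add, add_mul, hx, hy]
  | tmul a b =>
    induction t using PreMin.induction_on with
    | zero => rw [mul_zero, map_zero, mul_zero]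
    | add x y hx hy => rw [mul_add, map_add, map_add, mul_add, hx, hy]
    | tmul a' b' =>
      rw [PreMin.tmul_mul_tmul]
      exact ZeroAtInftyContinuousMap.ext fun x => (smul_mul_smul_comm (b x) a (b' x) a').symm

lemma toFunctions_star (t : PreMin A C₀(X, ℂ)) :
    toFunctions A X (star t) = star (toFunctions A X t) := by
  induction t using PreMin.induction_on with
  | zero => rw [star_zero, map_zero, star_zero]
  | add s t hs ht => rw [star_add, map_add, map_add, star_add, hs, ht]
  | tmul a b =>
    rw [PreMin.star_tmul]
    exact ZeroAtInftyContinuousMap.ext fun x => (star_smul (b x) a).symm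

end Functions

section HilbertTensor

variable {H : Type u} [NormedAddCommGroup H] [InnerProductSpace ℂ H]
variable {K : Type v} [NormedAddCommGroup K] [InnerProductSpace ℂ K]

lemma norm_hmul (h : H) (k : K) : ‖hmul h k‖ = ‖h‖ * ‖k‖ := by
  rw [← sq_eq_sq₀ (norm_nonneg _) (by positivity), mul_pow]
  have := inner_hmul h h k k
  simp only [inner_self_eq_norm_sq_to_K] at this
  exact_mod_cast this

lemma norm_le_norm_opTensor_one [Nontrivial K] (S : H →L[ℂ] H) :
    ‖S‖ ≤ ‖opTensor S (1 : K →L[ℂ] K)‖ := by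
  obtain ⟨k, hk⟩ := exists_ne (0 : K)
  refine ContinuousLinearMap.opNorm_le_bound _ (norm_nonneg _) fun h => ?_
  have := (opTensor S (1 : K →L[ℂ] K)).le_opNorm (hmul h k)
  rw [opTensor_hmul, one_apply_eq_self, norm_hmul, norm_hmul, ← mul_assoc] at this
  exact le_of_mul_le_mul_right this (norm_pos_iff.2 hk)

lemma opTensor_mul (S S' : H →L[ℂ] H) (T T' : K →L[ℂ] K) :
    opTensor S T * opTensor S' T' = opTensor (S * S') (T * T') :=
  hilbertTensor_clm_ext fun h k => by simp

lemma opTensor_add_left (S S' : H →L[ℂ] H) (T : K →L[ℂ] K) :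
    opTensor (S + S') T = opTensor S T + opTensor S' T :=
  hilbertTensor_clm_ext fun h k => by simp [hmul_add_left]

lemma opTensor_add_right (S : H →L[ℂ] H) (T T' : K →L[ℂ] K) :
    opTensor S (T + T') = opTensor S T + opTensor S T' :=
  hilbertTensor_clm_ext fun h k => by simp [hmul_add_right]

lemma opTensor_smul_left (c : ℂ) (S : H →L[ℂ] H) (T : K →L[ℂ] K) :
    opTensor (c • S) T = c • opTensor S T :=
  hilbertTensor_clm_ext fun h k => by simp [hmul_smul_left]

lemma opTensor_smul_right (c : ℂ) (S : H →L[ℂ] H) (T : K →L[ℂ] K) :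
    opTensor S (c • T) = c • opTensor S T :=
  hilbertTensor_clm_ext fun h k => by simp [hmul_smul_right]

lemma opTensor_zero_left (T : K →L[ℂ] K) : opTensor (0 : H →L[ℂ] H) T = 0 := by
  simpa using opTensor_smul_left 0 (0 : H →L[ℂ] H) T

lemma opTensor_zero_right (S : H →L[ℂ] H) : opTensor S (0 : K →L[ℂ] K) = 0 := by
  simpa using opTensor_smul_right 0 S (0 : K →L[ℂ] K)

lemma opTensor_sub_right (S : H →L[ℂ] H) (T T' : K →L[ℂ] K) :
    opTensor S (T - T') = opTensor S T - opTensor S T' := by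
  rw [eq_sub_iff_add_eq, ← opTensor_add_right, sub_add_cancel]

end HilbertTensor

section MulOp

variable {X : Type v} [TopologicalSpace X]
variable {H : Type u} [NormedAddCommGroup H] [InnerProductSpace ℂ H]
variable {K : Type v} [NormedAddCommGroup K] [InnerProductSpace ℂ K] [CompleteSpace K]

/-- The action of `C₀(X)` on `A ⊗ C₀(X)` in the representation `π ⊗ σ`. -/
def mulOp (H : Type u) [NormedAddCommGroup H] [InnerProductSpace ℂ H]
    (σ : C₀(X, ℂ) →⋆ₙₐ[ℂ] (K →L[ℂ] K)) (h : C₀(X, ℂ)) :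
    HilbertTensor H K →L[ℂ] HilbertTensor H K := opTensor 1 (σ h)

variable (σ : C₀(X, ℂ) →⋆ₙₐ[ℂ] (K →L[ℂ] K))

lemma norm_mulOp_le {h : C₀(X, ℂ)} (hh : ‖h‖ ≤ 1) : ‖mulOp H σ h‖ ≤ 1 := by
  refine (norm_opTensor_le _ _).trans (mul_le_one₀ ContinuousLinearMap.norm_id_le (norm_nonneg _) ?_)
  exact (NonUnitalStarAlgHom.norm_apply_le σ h).trans hh

lemma mulOp_mul (g h : C₀(X, ℂ)) : mulOp H σ g * mulOp H σ h = mulOp H σ (g * h) := by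
  rw [mulOp, mulOp, mulOp, opTensor_mul, one_mul, map_mul]

lemma mulOp_add (g h : C₀(X, ℂ)) : mulOp H σ (g + h) = mulOp H σ g + mulOp H σ h := by
  rw [mulOp, mulOp, mulOp, map_add, opTensor_add_right]

end MulOp

section Evaluation

variable {A : Type u} [NonUnitalCStarAlgebra A] {X : Type v} [TopologicalSpace X]
variable {H : Type u} [NormedAddCommGroup H] [InnerProductSpace ℂ H] [CompleteSpace H]
variable {K : Type v} [NormedAddCommGroup K] [InnerProductSpace ℂ K] [CompleteSpace K]

/-- Evaluation at a point, as a representation by scalar operators. -/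
def evalRep (K : Type v) [NormedAddCommGroup K] [InnerProductSpace ℂ K] [CompleteSpace K] (x : X) :
    C₀(X, ℂ) →⋆ₙₐ[ℂ] (K →L[ℂ] K) where
  toFun f := f x • 1
  map_smul' c f := by simp [mul_smul]
  map_zero' := by simp
  map_add' f g := by simp [add_smul]
  map_mul' f g := by simp [smul_smul, mul_comm]
  map_star' f := by simp [star_smul]

lemma evalRep_apply (x : X) (f : C₀(X, ℂ)) : evalRep K x f = f x • 1 := rfl

/-- Scalars pass across the tensor sign, so representing `C₀(X)` by evaluation at `x` turns `π ⊗ σ`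
into `π` applied to the value at `x`. -/
lemma rep_evalRep (π : A →⋆ₙₐ[ℂ] (H →L[ℂ] H)) (x : X) (t : PreMin A C₀(X, ℂ)) :
    PreMin.rep π (evalRep K x) t = opTensor (π (toFunctions A X t x)) 1 := by
  induction t using PreMin.induction_on with
  | zero => simp [opTensor_zero_left]
  | add s t hs ht =>
    rw [map_add, hs, ht, map_add, ZeroAtInftyContinuousMap.add_apply, map_add, opTensor_add_left]
  | tmul a f =>
    rw [PreMin.rep_tmul, evalRep_apply, toFunctions_tmul, smulConst_apply, map_smul,
      opTensor_smul_left, opTensor_smul_right]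

/-- Each value at a point is seen by a representation `π ⊗ evalRep K x` with `π` isometric.
Simplicity enters only to supply such a `π`. -/
lemma norm_toFunctions_le (hA : IsSimpleCStarAlgebra A) (t : PreMin A C₀(X, ℂ)) :
    ‖toFunctions A X t‖ ≤ ‖t‖ := by
  obtain ⟨H, _, _, _, π, hπ⟩ := hA.exists_isometric_representation
  refine norm_le (norm_nonneg t) fun x => ?_
  rw [← hπ]
  -- Any nonzero `K` would serve; this one is one-dimensional and lies in the universe of `X`.
  refine (norm_le_norm_opTensor_one (K := EuclideanSpace ℂ PUnit.{v + 1}) _).trans ?_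
  rw [← rep_evalRep]
  exact PreMin.norm_rep_le _ _ _

variable (π : A →⋆ₙₐ[ℂ] (H →L[ℂ] H)) (σ : C₀(X, ℂ) →⋆ₙₐ[ℂ] (K →L[ℂ] K))

lemma mulOp_star (h : C₀(X, ℂ)) : mulOp H σ (star h) = star (mulOp H σ h) := by
  rw [mulOp, mulOp, map_star, ← opTensor_adjoint, star_one]

lemma mulOp_mul_tmul (h : C₀(X, ℂ)) (a : A) (f : C₀(X, ℂ)) :
    mulOp H σ h * PreMin.rep π σ (PreMin.tmul a f) = opTensor (π a) (σ (h * f)) := by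
  rw [mulOp, PreMin.rep_tmul, opTensor_mul, one_mul, map_mul]

lemma mulOp_commute (h : C₀(X, ℂ)) (t : PreMin A C₀(X, ℂ)) :
    Commute (mulOp H σ h) (PreMin.rep π σ t) := by
  induction t using PreMin.induction_on with
  | zero => rw [map_zero]; exact Commute.zero_right _
  | add s t hs ht => rw [map_add]; exact hs.add_right ht
  | tmul a f =>
    rw [commute_iff_eq, mulOp_mul_tmul, mulOp, PreMin.rep_tmul, opTensor_mul, mul_one, ← map_mul,
      mul_comm h f]

/-- Near a point `x`, a tensor is close to its constant value at `x`. -/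
lemma exists_nhds_norm_mulOp_sub_le (t : PreMin A C₀(X, ℂ)) (x : X) {ε : ℝ} (hε : 0 < ε) :
    ∃ U : Set X, IsOpen U ∧ x ∈ U ∧ ∀ h : C₀(X, ℂ), ‖h‖ ≤ 1 → (∀ y ∉ U, h y = 0) →
      ‖mulOp H σ h * PreMin.rep π σ t - opTensor (π (toFunctions A X t x)) (σ h)‖ ≤ ε := by
  induction t using PreMin.induction_on generalizing ε with
  | zero =>
    refine ⟨Set.univ, isOpen_univ, trivial, fun h _ _ => ?_⟩
    simp [opTensor_zero_left, hε.le]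
  | add s t hs ht =>
    obtain ⟨U, hU, hxU, hU'⟩ := hs (half_pos hε)
    obtain ⟨V, hV, hxV, hV'⟩ := ht (half_pos hε)
    refine ⟨U ∩ V, hU.inter hV, ⟨hxU, hxV⟩, fun h h1 h0 => ?_⟩
    have hu := hU' h h1 fun y hy => h0 y fun hy' => hy hy'.1
    have hv := hV' h h1 fun y hy => h0 y fun hy' => hy hy'.2
    rw [map_add, mul_add, map_add, ZeroAtInftyContinuousMap.add_apply, map_add,
      opTensor_add_left, add_sub_add_comm]
    linarith [norm_add_le_of_le hu hv]
  | tmul a f =>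
    have hpos : 0 < ε / (‖a‖ + 1) := by positivity
    refine ⟨{y | ‖f y - f x‖ < ε / (‖a‖ + 1)}, isOpen_lt (by fun_prop) (by fun_prop), by simpa,
      fun h h1 h0 => ?_⟩
    rw [mulOp_mul_tmul, toFunctions_tmul, smulConst_apply, map_smul, opTensor_smul_left,
      ← opTensor_smul_right, ← map_smul, ← opTensor_sub_right, ← map_sub]
    -- On `U` the function `f` is close to `f x`, and off `U` the factor `h` vanishes. The `+ 1` in
    -- the denominator covers `a = 0`.
    have h2 : ‖h * f - f x • h‖ ≤ ε / (‖a‖ + 1) := by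
      refine norm_le hpos.le fun y => ?_
      have : (h * f - f x • h) y = h y * (f y - f x) := by
        simp; ring
      rw [this]
      by_cases hy : ‖f y - f x‖ < ε / (‖a‖ + 1)
      · rw [norm_mul]
        exact (mul_le_of_le_one_left (norm_nonneg _) ((norm_apply_le h y).trans h1)).trans hy.le
      · rw [h0 y hy, zero_mul, norm_zero]
        exact hpos.le
    calc _ ≤ ‖a‖ * (ε / (‖a‖ + 1)) := (norm_opTensor_le _ _).trans (mul_le_mul
          (NonUnitalStarAlgHom.norm_apply_le π a)
          ((NonUnitalStarAlgHom.norm_apply_le σ _).trans h2) (norm_nonneg _) (norm_nonneg _))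
      _ ≤ (‖a‖ + 1) * (ε / (‖a‖ + 1)) := by gcongr; linarith
      _ = ε := by field_simp

/-- Outside a compact set, a tensor is small. -/
lemma exists_isCompact_norm_mulOp_sub_le (t : PreMin A C₀(X, ℂ)) {ε : ℝ} (hε : 0 < ε) :
    ∃ L : Set X, IsCompact L ∧ ∀ h : C₀(X, ℂ), (∀ y, ‖1 - h y‖ ≤ 1) → (∀ y ∈ L, h y = 1) →
      ‖mulOp H σ h * PreMin.rep π σ t - PreMin.rep π σ t‖ ≤ ε := by
  induction t using PreMin.induction_on generalizing ε with
  | zero =>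
    refine ⟨∅, isCompact_empty, fun h _ _ => ?_⟩
    simp [hε.le]
  | add s t hs ht =>
    obtain ⟨U, hU, hU'⟩ := hs (half_pos hε)
    obtain ⟨V, hV, hV'⟩ := ht (half_pos hε)
    refine ⟨U ∪ V, hU.union hV, fun h h1 h0 => ?_⟩
    have hu := hU' h h1 fun y hy => h0 y (Or.inl hy)
    have hv := hV' h h1 fun y hy => h0 y (Or.inr hy)
    rw [map_add, mul_add, add_sub_add_comm]
    linarith [norm_add_le_of_le hu hv]
  | tmul a f =>
    have hpos : 0 < ε / (‖a‖ + 1) := by positivity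
    obtain ⟨L, hL, hL'⟩ := Filter.mem_cocompact.1
      ((zero_at_infty f).norm.eventually_lt_const (by simpa using hpos))
    refine ⟨L, hL, fun h h1 h0 => ?_⟩
    rw [mulOp_mul_tmul, PreMin.rep_tmul, ← opTensor_sub_right, ← map_sub]
    have h2 : ‖h * f - f‖ ≤ ε / (‖a‖ + 1) := by
      refine norm_le hpos.le fun y => ?_
      have : (h * f - f) y = -((1 - h y) * f y) := by
        simp; ring
      rw [this, norm_neg]
      by_cases hy : y ∈ L
      · rw [h0 y hy, sub_self, zero_mul, norm_zero]
        exact hpos.le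
      · rw [norm_mul]
        exact (mul_le_of_le_one_left (norm_nonneg _) (h1 y)).trans (hL' hy).le
    calc _ ≤ ‖a‖ * (ε / (‖a‖ + 1)) := (norm_opTensor_le _ _).trans (mul_le_mul
          (NonUnitalStarAlgHom.norm_apply_le π a)
          ((NonUnitalStarAlgHom.norm_apply_le σ _).trans h2) (norm_nonneg _) (norm_nonneg _))
      _ ≤ (‖a‖ + 1) * (ε / (‖a‖ + 1)) := by gcongr; linarith
      _ = ε := by field_simp

end Evaluation

end CStarTensor

/-! ### Partitions of unity with enlarged bumps. -/

/-- A finite partition of unity near a compact set `L` subordinate to a cover given by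
neighbourhoods of its points, with bump functions equal to one on the supports. -/
lemma exists_local_partition {X : Type v} [TopologicalSpace X] [LocallyCompactSpace X] [T2Space X]
    {L : Set X} (hL : IsCompact L) (U : X → Set X) (hU : ∀ x ∈ L, IsOpen (U x) ∧ x ∈ U x) :
    ∃ (n : ℕ) (x : Fin n → X) (g g' : Fin n → C₀(X, ℂ)), (∀ j, x j ∈ L) ∧ (∀ j, ‖g j‖ ≤ 1) ∧
      (∀ j, ‖g' j‖ ≤ 1) ∧ (∀ j, g j * g' j = g j) ∧ (∀ j, ∀ y ∉ U (x j), g' j y = 0) ∧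
      (∀ y ∈ L, ∑ j, g j y = 1) ∧ ∀ y ∈ L, ∑ j, ‖g j y‖ = 1 := by
  -- An intermediate compact neighbourhood: `g j` is supported inside `V`, while `g' j` is one on
  -- `V` and zero off `U`. This yields `g j * g' j = g j`.
  have hV : ∀ x ∈ L, ∃ V : Set X, IsCompact V ∧ x ∈ interior V ∧ V ⊆ U x := fun x hx => by
    obtain ⟨V, hV, hxV, hVU⟩ := exists_compact_subset (hU x hx).1 (hU x hx).2
    exact ⟨V, hV, hxV, hVU⟩
  choose! V hVc hxV hVU using hV
  obtain ⟨t, hcov⟩ := hL.elim_nhds_subcover' (fun x _ => interior (V x))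
    (fun x hx => isOpen_interior.mem_nhds (hxV x hx))
  obtain ⟨n, ⟨eq⟩⟩ : ∃ n, Nonempty (Fin n ≃ t) := ⟨_, ⟨(Fintype.equivFin t).symm⟩⟩
  let x : Fin n → X := fun j => ((eq j : L) : X)
  have hx : ∀ j, x j ∈ L := fun j => (eq j : L).2
  have hbump : ∀ j, ∃ f : C(X, ℝ), Set.EqOn f 1 (V (x j)) ∧ Set.EqOn f 0 (U (x j))ᶜ ∧
      HasCompactSupport f ∧ ∀ y, f y ∈ Set.Icc (0 : ℝ) 1 := fun j =>
    exists_continuous_one_zero_of_isCompact (hVc _ (hx j)) (hU _ (hx j)).1.isClosed_compl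
      (Set.disjoint_compl_right_iff_subset.2 (hVU _ (hx j)))
  choose b hb1 hb0 hbc hbI using hbump
  obtain ⟨f, hfs, hf1, hfI, hfc⟩ := exists_continuous_sum_one_of_isOpen_isCompact
    (s := fun j => interior (V (x j))) (fun j => isOpen_interior) hL (fun y hy => by
      obtain ⟨z, hz, hyz⟩ := Set.mem_iUnion₂.1 (hcov hy)
      refine Set.mem_iUnion.2 ⟨eq.symm ⟨z, hz⟩, ?_⟩
      simpa [x] using hyz)
  have hsum : ∀ y ∈ L, ∑ j, f j y = 1 := fun y hy => by simpa using hf1 hy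
  refine ⟨n, x, fun j => ofRealCompactSupport (f j) (hfc j),
    fun j => ofRealCompactSupport (b j) (hbc j), hx,
    fun j => norm_ofRealCompactSupport_le _ (hfI j),
    fun j => norm_ofRealCompactSupport_le _ (hbI j), fun j => ?_, fun j y hy => ?_,
    fun y hy => ?_, fun y hy => ?_⟩
  · ext y
    by_cases hy : y ∈ V (x j)
    · have := hb1 j hy
      simp only [Pi.one_apply] at this
      simp [this]
    · have : f j y = 0 := image_eq_zero_of_notMem_tsupport
        fun h => hy (interior_subset (hfs j h))
      simp [this]
  · have := hb0 j hy
    simp only [Pi.zero_apply] at this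
    simp [this]
  · simp only [ofRealCompactSupport_apply]
    exact_mod_cast hsum y hy
  · rw [← hsum y hy]
    refine Finset.sum_congr rfl fun j _ => ?_
    rw [ofRealCompactSupport_apply, Complex.norm_real, Real.norm_of_nonneg (hfI j y).1]

/-! ### The minimal norm is the supremum norm. -/

namespace CStarTensor

variable {A : Type u} [NonUnitalCStarAlgebra A]
variable {X : Type v} [TopologicalSpace X] [LocallyCompactSpace X] [T2Space X]

/-- Cut off to a compact set at cost `ε / 2`. On small patches the operator is within `ε / 2` of `π
(q x) ⊗ σ (g')`, whose norm is at most the supremum norm of `q`; `IsSelfAdjoint.norm_le_of_local`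
glues the patches, which is why `q` is selfadjoint. -/
lemma norm_rep_le_norm_toFunctions {H : Type u} [NormedAddCommGroup H] [InnerProductSpace ℂ H]
    [CompleteSpace H] {K : Type v} [NormedAddCommGroup K] [InnerProductSpace ℂ K] [CompleteSpace K]
    (π : A →⋆ₙₐ[ℂ] (H →L[ℂ] H)) (σ : C₀(X, ℂ) →⋆ₙₐ[ℂ] (K →L[ℂ] K)) {q : PreMin A C₀(X, ℂ)}
    (hq : IsSelfAdjoint q) : ‖PreMin.rep π σ q‖ ≤ ‖toFunctions A X q‖ := by
  refine le_of_forall_pos_le_add fun ε hε => ?_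
  set T := PreMin.rep π σ q with hT
  set c := ‖toFunctions A X q‖ with hc
  have hTs : star T = T := by rw [hT, ← PreMin.rep_star, hq.star_eq]
  obtain ⟨L, hL, hL'⟩ := exists_isCompact_norm_mulOp_sub_le π σ q (half_pos hε)
  obtain ⟨e, he1, -, hec, heI⟩ : ∃ f : C(X, ℝ), Set.EqOn f 1 L ∧ Set.EqOn f 0 ∅ ∧
      HasCompactSupport f ∧ ∀ y, f y ∈ Set.Icc (0 : ℝ) 1 :=
    exists_continuous_one_zero_of_isCompact hL isClosed_empty (Set.disjoint_empty L)
  let e' := ofRealCompactSupport e hec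
  have he'1 : ‖mulOp H σ e'‖ ≤ 1 := norm_mulOp_le σ (norm_ofRealCompactSupport_le hec heI)
  have hcut : ‖mulOp H σ e' * T - T‖ ≤ ε / 2 := by
    refine hL' e' (fun y => ?_) fun y hy => ?_
    · have : 1 - e' y = ((1 - e y : ℝ) : ℂ) := by simp [e']
      rw [this, Complex.norm_real, Real.norm_of_nonneg (by linarith [(heI y).2])]
      linarith [(heI y).1]
    · have := he1 hy
      simp only [Pi.one_apply] at this
      simp [e', this]
  choose U hUo hxU hU using fun x : X => exists_nhds_norm_mulOp_sub_le π σ q x (half_pos hε)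
  -- The partition covers the support of the cutoff `e`, not merely `L`, so that `∑ j, g j * e' =
  -- e'` holds exactly.
  obtain ⟨n, x, g, g', -, hg, hg', hgg', hg'0, hsum, -⟩ :=
    exists_local_partition hec U fun x _ => ⟨hUo x, hxU x⟩
  have hloc : ∀ j, ‖mulOp H σ (g' j) * T‖ ≤ c + ε / 2 := fun j => by
    have h1 := hU (x j) (g' j) (hg' j) (hg'0 j)
    have h2 : ‖opTensor (π (toFunctions A X q (x j))) (σ (g' j))‖ ≤ c := by
      refine (norm_opTensor_le _ _).trans ?_
      refine (mul_le_of_le_one_right (norm_nonneg _)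
        ((NonUnitalStarAlgHom.norm_apply_le σ _).trans (hg' j))).trans ?_
      exact (NonUnitalStarAlgHom.norm_apply_le π _).trans (norm_apply_le _ _)
    have := norm_add_le_of_le h1 h2
    rw [sub_add_cancel] at this
    linarith
  have hcomm : ∀ h, Commute (mulOp H σ h) T := fun h => mulOp_commute π σ h q
  have hcomm' : ∀ g h, Commute (mulOp H σ g) (mulOp H σ h) := fun g h => by
    rw [commute_iff_eq, mulOp_mul, mulOp_mul, mul_comm]
  have hsum' : ∑ j, mulOp H σ (g j) * mulOp H σ e' = mulOp H σ e' := by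
    have : ∑ j, g j * e' = e' := by
      ext y
      have h1 : (∑ j, g j * e') y = (∑ j, g j y) * e' y := by
        have : ∀ s : Finset (Fin n), (∑ j ∈ s, g j * e') y = (∑ j ∈ s, g j y) * e' y := fun s => by
          induction s using Finset.induction_on with
          | empty => simp
          | insert a s ha ih =>
            rw [Finset.sum_insert ha, Finset.sum_insert ha, add_mul, ← ih]; rfl
        exact this _
      rw [h1]
      by_cases hy : y ∈ tsupport e
      · rw [hsum y hy, one_mul]
      · have : e y = 0 := image_eq_zero_of_notMem_tsupport hy
        simp [e', this]
    have h2 : ∀ s : Finset (Fin n), ∑ j ∈ s, mulOp H σ (g j) * mulOp H σ e'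
        = mulOp H σ (∑ j ∈ s, g j * e') := fun s => by
      induction s using Finset.induction_on with
      | empty => simp [mulOp, opTensor_zero_right]
      | insert a s ha ih =>
        rw [Finset.sum_insert ha, Finset.sum_insert ha, mulOp_add, ih, mulOp_mul]
    rw [h2, this]
  have hS : IsSelfAdjoint (mulOp H σ e' * T) := by
    rw [IsSelfAdjoint, star_mul, hTs, ← mulOp_star, star_ofRealCompactSupport]
    exact (hcomm e').eq.symm
  have hSn : ‖mulOp H σ e' * T‖ ≤ c + ε / 2 := by
    refine hS.norm_le_of_local (G := fun j => mulOp H σ (g j)) (G' := fun j => mulOp H σ (g' j))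
      (fun j => norm_mulOp_le σ (hg j)) (fun j => by rw [mulOp_mul, hgg'])
      (fun j => (hcomm' _ _).mul_right (hcomm _)) ?_ (fun j => ?_) (by positivity)
    · simp only [← mul_assoc]
      rw [← Finset.sum_mul, hsum']
    · rw [← mul_assoc, (hcomm' (g' j) e').eq, mul_assoc]
      exact (norm_mul_le _ _).trans
        ((mul_le_of_le_one_left (norm_nonneg _) he'1).trans (hloc j))
  have := norm_sub_le_of_le hSn hcut
  rw [sub_sub_cancel] at this
  linarith

/-- The minimal norm on `A ⊗ C₀(X)` is the norm of `C₀(X, A)`, for `A` simple. -/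
lemma norm_toFunctions (hA : IsSimpleCStarAlgebra A) (t : PreMin A C₀(X, ℂ)) :
    ‖toFunctions A X t‖ = ‖t‖ := by
  refine le_antisymm (norm_toFunctions_le hA t) (PreMin.norm_le ?_)
  intro H _ _ _ K _ _ _ π σ
  -- The C⋆-identity on both sides reduces the bound for `t` to the selfadjoint `star t * t`.
  have h := norm_rep_le_norm_toFunctions π σ (IsSelfAdjoint.star_mul_self t)
  rw [PreMin.rep_mul, PreMin.rep_star, CStarRing.norm_star_mul_self, toFunctions_mul,
    toFunctions_star, CStarRing.norm_star_mul_self] at h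
  exact (mul_self_le_mul_self_iff (norm_nonneg _) (norm_nonneg _)).2 h

end CStarTensor

/-! ### Closed ideals in the function model. -/

lemma IsSimpleCStarAlgebra.topologicalClosure_eq_top {A : Type u} [NonUnitalCStarAlgebra A]
    (hA : IsSimpleCStarAlgebra A) {J : Submodule ℂ A} (hl : ∀ a, ∀ x ∈ J, a * x ∈ J)
    (hr : ∀ a, ∀ x ∈ J, x * a ∈ J) {b : A} (hb : b ∈ J) (hb0 : b ≠ 0) :
    J.topologicalClosure = ⊤ := by
  refine (hA.eq_bot_or_eq_top _ ⟨J.isClosed_topologicalClosure, fun a x hx => ?_,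
    fun a x hx => ?_⟩).resolve_left fun h => hb0 ?_
  · exact map_mem_closure (f := fun x => a * x) (by fun_prop) hx (hl a)
  · exact map_mem_closure (f := fun x => x * a) (by fun_prop) hx (hr a)
  · have := J.le_topologicalClosure hb
    rwa [h, Submodule.mem_bot] at this

namespace CStarTensor

variable {A : Type u} [NonUnitalCStarAlgebra A]
variable {X : Type v} [TopologicalSpace X]

/-- Such an `f` makes `a ⊗ f` an element with value `a` at `x`. -/
lemma exists_apply_eq_one [LocallyCompactSpace X] [T2Space X] (x : X) :
    ∃ f : C₀(X, ℂ), f x = 1 := by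
  obtain ⟨f, hf, -, hfc, -⟩ := exists_continuous_one_zero_of_isCompact
    (isCompact_singleton (x := x)) isClosed_empty (Set.disjoint_empty _)
  refine ⟨ofRealCompactSupport f hfc, ?_⟩
  have := hf (Set.mem_singleton x)
  simp only [Pi.one_apply] at this
  simp [this]

/-- The structure of `A ⊗ C₀(X)` as an algebra of `A`-valued functions on `X`. -/
structure FunctionModel (A : Type u) [NonUnitalCStarAlgebra A] (X : Type v) [TopologicalSpace X]
    where
  /-- The embedding into `C₀(X, A)`. -/
  toFun : MinTensor A C₀(X, ℂ) →ₗᵢ[ℂ] C₀(X, A)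
  apply_tmul : ∀ a f x, toFun (MinTensor.tmul a f) x = f x • a
  apply_mul : ∀ m m' x, toFun (m * m') x = toFun m x * toFun m' x

/-- For `A` simple, `A ⊗ C₀(X)` embeds isometrically into `C₀(X, A)`. -/
def functionModel [LocallyCompactSpace X] [T2Space X] (hA : IsSimpleCStarAlgebra A) :
    FunctionModel A X :=
  let e : PreMin A C₀(X, ℂ) →ₗ[ℂ] MinTensor A C₀(X, ℂ) := (MinTensor.ofPre A C₀(X, ℂ)).toLinearMap
  have hd : DenseRange e := MinTensor.denseRange_ofPre A C₀(X, ℂ)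
  have hn : ∀ t, ‖toFunctions A X t‖ ≤ 1 * ‖e t‖ := fun t => by
    rw [norm_toFunctions hA, one_mul]
    exact ((MinTensor.ofPre A C₀(X, ℂ)).norm_map t).ge
  let Φ := (toFunctions A X).extendOfNorm e
  have hΦ : ∀ t, Φ (MinTensor.ofPre A C₀(X, ℂ) t) = toFunctions A X t :=
    LinearMap.extendOfNorm_eq hd ⟨1, hn⟩
  { toFun :=
      { Φ.toLinearMap with
        norm_map' := fun m => by
          change ‖Φ m‖ = ‖m‖
          refine MinTensor.induction_on m (isClosed_eq (by fun_prop) (by fun_prop)) fun t => ?_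
          rw [hΦ, norm_toFunctions hA, LinearIsometry.norm_map] }
    apply_tmul := fun a f x => by
      change Φ (MinTensor.ofPre A C₀(X, ℂ) (PreMin.tmul a f)) x = _
      rw [hΦ]
      rfl
    apply_mul := fun m m' x => by
      have : Φ (m * m') = Φ m * Φ m' := by
        refine MinTensor.induction_on m (isClosed_eq (by fun_prop) (by fun_prop)) fun s => ?_
        refine MinTensor.induction_on m' (isClosed_eq (by fun_prop) (by fun_prop)) fun t => ?_
        rw [← MinTensor.ofPre_mul, hΦ, hΦ, hΦ, toFunctions_mul]
      exact congrArg (fun f : C₀(X, A) => f x) this }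

namespace FunctionModel

variable (Φ : FunctionModel A X)

lemma ext {m m' : MinTensor A C₀(X, ℂ)} (h : ∀ x, Φ.toFun m x = Φ.toFun m' x) : m = m' :=
  Φ.toFun.injective (ZeroAtInftyContinuousMap.ext h)

variable [LocallyCompactSpace X] [T2Space X]

/-- At a point where a closed ideal `I` does not vanish, every value is approximated by functions
`c` whose multiples `h • c` all lie in `I`. -/
lemma exists_local_approx (hA : IsSimpleCStarAlgebra A) {I : Submodule ℂ (MinTensor A C₀(X, ℂ))}
    (hI : IsClosedIdeal I) {x : X} (hx : ∃ i ∈ I, Φ.toFun i x ≠ 0) (b : A) {δ : ℝ} (hδ : 0 < δ) :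
    ∃ c : X → A, Continuous c ∧ ‖c x - b‖ < δ ∧
      ∀ h : C₀(X, ℂ), ∃ i ∈ I, ∀ y, Φ.toFun i y = h y • c y := by
  -- The left factor `a` leaves room for `h`: the element `(a ⊗ h) * i` of `I` has values `h y • (a
  -- * Φ.toFun i y)`, so no separate action of `C₀(X)` on `I` is needed.
  let J : Submodule ℂ A := Submodule.span ℂ {b | ∃ a : A, ∃ i ∈ I, b = a * Φ.toFun i x}
  have hl : ∀ a, ∀ b ∈ J, a * b ∈ J := fun a b hb => by
    induction hb using Submodule.span_induction with
    | mem b hb =>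
      obtain ⟨a', i, hi, rfl⟩ := hb
      exact Submodule.subset_span ⟨a * a', i, hi, (mul_assoc _ _ _).symm⟩
    | zero => rw [mul_zero]; exact J.zero_mem
    | add b b' _ _ hb hb' => rw [mul_add]; exact J.add_mem hb hb'
    | smul c b _ hb => rw [mul_smul_comm]; exact J.smul_mem c hb
  have hr : ∀ a, ∀ b ∈ J, b * a ∈ J := fun a b hb => by
    induction hb using Submodule.span_induction with
    | mem b hb =>
      obtain ⟨a', i, hi, rfl⟩ := hb
      obtain ⟨f, hf⟩ := exists_apply_eq_one x
      refine Submodule.subset_span ⟨a', i * MinTensor.tmul a f, hI.mul_mem_right _ _ hi, ?_⟩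
      rw [Φ.apply_mul, Φ.apply_tmul, hf, one_smul, mul_assoc]
    | zero => rw [zero_mul]; exact J.zero_mem
    | add b b' _ _ hb hb' => rw [add_mul]; exact J.add_mem hb hb'
    | smul c b _ hb => rw [smul_mul_assoc]; exact J.smul_mem c hb
  obtain ⟨i, hi, hix⟩ := hx
  have htop : J.topologicalClosure = ⊤ := hA.topologicalClosure_eq_top hl hr
    (b := star (Φ.toFun i x) * Φ.toFun i x) (Submodule.subset_span ⟨_, i, hi, rfl⟩)
    (by rwa [ne_eq, CStarRing.star_mul_self_eq_zero_iff])
  have hb : b ∈ closure (J : Set A) := by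
    rw [← Submodule.topologicalClosure_coe, htop]; trivial
  obtain ⟨b', hb', hbb'⟩ := Metric.mem_closure_iff.1 hb δ hδ
  -- On `J` itself the value is attained exactly, and this exact statement passes through the span.
  suffices H : ∃ c : X → A, Continuous c ∧ c x = b' ∧
      ∀ h : C₀(X, ℂ), ∃ i ∈ I, ∀ y, Φ.toFun i y = h y • c y by
    obtain ⟨c, hc, hcx, hcI⟩ := H
    exact ⟨c, hc, by rwa [hcx, ← dist_eq_norm, dist_comm], hcI⟩
  clear hbb'
  induction hb' using Submodule.span_induction with
  | mem b hb =>
    obtain ⟨a, i, hi, rfl⟩ := hb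
    refine ⟨fun y => a * Φ.toFun i y, by fun_prop, rfl, fun h =>
      ⟨MinTensor.tmul a h * i, hI.mul_mem_left _ _ hi, fun y => ?_⟩⟩
    rw [Φ.apply_mul, Φ.apply_tmul, smul_mul_assoc]
  | zero => exact ⟨0, continuous_zero, rfl, fun h => ⟨0, I.zero_mem, fun y => by simp⟩⟩
  | add b b' _ _ hb hb' =>
    obtain ⟨c, hc, hcx, hcI⟩ := hb
    obtain ⟨c', hc', hcx', hcI'⟩ := hb'
    refine ⟨c + c', hc.add hc', by rw [Pi.add_apply, hcx, hcx'], fun h => ?_⟩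
    obtain ⟨i, hi, hiy⟩ := hcI h
    obtain ⟨i', hi', hiy'⟩ := hcI' h
    exact ⟨i + i', I.add_mem hi hi', fun y => by simp [hiy, hiy']⟩
  | smul r b _ hb =>
    obtain ⟨c, hc, hcx, hcI⟩ := hb
    refine ⟨r • c, hc.const_smul r, by rw [Pi.smul_apply, hcx], fun h => ?_⟩
    obtain ⟨i, hi, hiy⟩ := hcI h
    exact ⟨r • i, I.smul_mem r hi, fun y => by simp [hiy, smul_comm r]⟩

/-- A closed ideal of `A ⊗ C₀(X)` contains everything that vanishes on its zero set. -/
lemma mem_of_vanishing (hA : IsSimpleCStarAlgebra A) {I : Submodule ℂ (MinTensor A C₀(X, ℂ))}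
    (hI : IsClosedIdeal I) {m : MinTensor A C₀(X, ℂ)}
    (hm : ∀ x, (∀ i ∈ I, Φ.toFun i x = 0) → Φ.toFun m x = 0) : m ∈ I := by
  have hmem : m ∈ closure (I : Set (MinTensor A C₀(X, ℂ))) := by
    refine Metric.mem_closure_iff.2 fun ε hε => ?_
    have hδ : 0 < ε / 2 := half_pos hε
    set δ := ε / 2 with hδε
    have hcont : Continuous fun y => ‖Φ.toFun m y‖ := by fun_prop
    have hL : IsCompact {y | δ ≤ ‖Φ.toFun m y‖} := by
      obtain ⟨L, hL, hL'⟩ := Filter.mem_cocompact.1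
        ((zero_at_infty (Φ.toFun m)).norm.eventually_lt_const (by simpa using hδ))
      refine hL.of_isClosed_subset (isClosed_le continuous_const hcont) fun y hy => ?_
      by_contra hyL
      have h : ‖Φ.toFun m y‖ < δ := hL' hyL
      exact absurd hy (not_le.2 h)
    -- The cutoff is one where `m` has norm at least `δ` and zero where it has norm at most `δ / 2`.
    -- Its closed support therefore stays in `{δ / 2 ≤ ‖m‖}`, away from the zero set of `I`.
    obtain ⟨e, he1, he0, hec, heI⟩ := exists_continuous_one_zero_of_isCompact hL
      (isClosed_le hcont (continuous_const (y := δ / 2)))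
      (Set.disjoint_left.2 fun y (hy : δ ≤ _) (hy' : _ ≤ δ / 2) => by linarith)
    have hsupp : ∀ y ∈ tsupport e, ∃ i ∈ I, Φ.toFun i y ≠ 0 := by
      have h1 : tsupport e ⊆ {y | δ / 2 ≤ ‖Φ.toFun m y‖} :=
        closure_minimal (fun y hy => by
          by_contra h
          have h' : ‖Φ.toFun m y‖ ≤ δ / 2 := (not_le.1 h).le
          exact hy (he0 h')) (isClosed_le continuous_const hcont)
      intro y hy
      by_contra! h
      have h2 : δ / 2 ≤ ‖Φ.toFun m y‖ := h1 hy
      rw [hm y h, norm_zero] at h2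
      linarith
    have happ := fun y (hy : y ∈ tsupport e) =>
      Φ.exists_local_approx hA hI (hsupp y hy) (Φ.toFun m y) hδ
    choose! c hc hcx hcI using happ
    obtain ⟨n, x, g, g', hx, -, -, hgg', hg'0, hsum, hsum'⟩ := exists_local_partition hec
      (fun x => {y | x ∈ tsupport e → ‖c x y - Φ.toFun m y‖ < δ}) fun x hx => by
        have := hc x hx
        simp only [hx, true_imp_iff]
        exact ⟨isOpen_lt (by fun_prop) continuous_const, hcx x hx⟩
    have hgj : ∀ j y, g j y ≠ 0 → ‖c (x j) y - Φ.toFun m y‖ < δ := fun j y hy => by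
      by_contra h
      have h1 : g' j y = 0 := hg'0 j y fun h' => h (h' (hx j))
      have h2 := congrArg (fun f : C₀(X, ℂ) => f y) (hgg' j)
      simp only [ZeroAtInftyContinuousMap.mul_apply, h1, mul_zero] at h2
      exact hy h2.symm
    choose i hiI hi using fun j => hcI (x j) (hx j) (ofRealCompactSupport e hec * g j)
    refine ⟨∑ j, i j, I.sum_mem fun j _ => hiI j, ?_⟩
    rw [dist_eq_norm, ← Φ.toFun.norm_map]
    refine (norm_le hδ.le fun y => ?_).trans_lt (half_lt_self hε)
    have hval : Φ.toFun (m - ∑ j, i j) y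
        = Φ.toFun m y - (e y : ℂ) • ∑ j, g j y • c (x j) y := by
      rw [map_sub, map_sum, ZeroAtInftyContinuousMap.sub_apply, Finset.smul_sum]
      congr 1
      have : ∀ s : Finset (Fin n), (∑ j ∈ s, Φ.toFun (i j)) y = ∑ j ∈ s, Φ.toFun (i j) y := fun s =>
        map_sum (⟨⟨fun f : C₀(X, A) => f y, rfl⟩, fun _ _ => rfl⟩ : C₀(X, A) →+ A) _ s
      rw [this]
      refine Finset.sum_congr rfl fun j _ => ?_
      rw [hi, ZeroAtInftyContinuousMap.mul_apply, ofRealCompactSupport_apply, mul_smul]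
    rw [hval]
    -- The error is split as `(1 - e) m + e (m - ∑ g j c j)`; the two bounds, with weights `1 - e y`
    -- and `e y`, add up to `δ`.
    have h1 : ‖((1 - e y : ℝ) : ℂ) • Φ.toFun m y‖ ≤ (1 - e y) * δ := by
      rw [norm_smul, Complex.norm_real, Real.norm_of_nonneg (by linarith [(heI y).2])]
      by_cases hy : δ ≤ ‖Φ.toFun m y‖
      · have : e y = 1 := he1 hy
        simp [this]
      · exact mul_le_mul_of_nonneg_left (not_le.1 hy).le (by linarith [(heI y).2])
    have h2 : ‖(e y : ℂ) • (Φ.toFun m y - ∑ j, g j y • c (x j) y)‖ ≤ e y * δ := by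
      rw [norm_smul, Complex.norm_real, Real.norm_of_nonneg (heI y).1]
      by_cases hy : y ∈ tsupport e
      · refine mul_le_mul_of_nonneg_left ?_ (heI y).1
        have : Φ.toFun m y - ∑ j, g j y • c (x j) y
            = ∑ j, g j y • (Φ.toFun m y - c (x j) y) := by
          simp only [smul_sub]
          rw [Finset.sum_sub_distrib, ← Finset.sum_smul, hsum y hy, one_smul]
        rw [this]
        calc _ ≤ ∑ j, ‖g j y‖ * δ := norm_sum_le_of_le _ fun j _ => by
              rw [norm_smul]
              by_cases h0 : g j y = 0
              · simp [h0]
              · rw [norm_sub_rev]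
                exact mul_le_mul_of_nonneg_left (hgj j y h0).le (norm_nonneg _)
          _ = δ := by rw [← Finset.sum_mul, hsum' y hy, one_mul]
      · have : e y = 0 := image_eq_zero_of_notMem_tsupport hy
        simp [this]
    have h3 := norm_add_le_of_le h1 h2
    have h4 : ((1 - e y : ℝ) : ℂ) • Φ.toFun m y
        + (e y : ℂ) • (Φ.toFun m y - ∑ j, g j y • c (x j) y)
        = Φ.toFun m y - (e y : ℂ) • ∑ j, g j y • c (x j) y := by
      rw [smul_sub, Complex.ofReal_sub, sub_smul, Complex.ofReal_one, one_smul]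
      abel
    rw [h4] at h3
    linarith
  rwa [hI.isClosed.closure_eq] at hmem

/-- An element of the Lie normalizer of `I` has central values on the zero set of `I`. -/
lemma commute_of_mem_lieNormalizer {I : Submodule ℂ (MinTensor A C₀(X, ℂ))}
    {m : MinTensor A C₀(X, ℂ)} (hm : m ∈ lieNormalizer I) {x : X}
    (hx : ∀ i ∈ I, Φ.toFun i x = 0) (b : A) : Commute (Φ.toFun m x) b := by
  obtain ⟨f, hf⟩ := exists_apply_eq_one x
  have := hx _ (hm (MinTensor.tmul b f))
  rwa [map_sub, ZeroAtInftyContinuousMap.sub_apply, Φ.apply_mul, Φ.apply_mul, Φ.apply_tmul, hf,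
    one_smul, sub_eq_zero] at this

end FunctionModel

end CStarTensor

/-! ### Computation of the Lie normalizer. -/

lemma IsClosedIdeal.le_lieNormalizer {M : Type*} [NonUnitalCStarAlgebra M] {I : Submodule ℂ M}
    (hI : IsClosedIdeal I) : I ≤ lieNormalizer I := fun _ hm b =>
  I.sub_mem (hI.mul_mem_right b _ hm) (hI.mul_mem_left b _ hm)

/-- The composition of a function vanishing at infinity with a continuous functional. -/
def ZeroAtInftyContinuousMap.compDual {X : Type v} [TopologicalSpace X] {E : Type*}
    [NormedAddCommGroup E] [NormedSpace ℂ E] (φ : StrongDual ℂ E) (f : C₀(X, E)) : C₀(X, ℂ) where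
  toFun x := φ (f x)
  continuous_toFun := by fun_prop
  zero_at_infty' := by
    simpa [Function.comp_def] using (φ.continuous.tendsto 0).comp (zero_at_infty f)

end

open CStarTensor in
theorem lemma4 {A : Type u} [NonUnitalCStarAlgebra A] (hA : IsSimpleCStarAlgebra A)
    {X : Type v} [TopologicalSpace X] [LocallyCompactSpace X] [T2Space X]
    (I : Submodule ℂ (CStarTensor.MinTensor A C₀(X, ℂ))) (hI : IsClosedIdeal I) :
    (∀ e : A, IsUnitElement e →
      lieNormalizer I = I ⊔ CStarTensor.MinTensor.subspaceTensor (ℂ ∙ e) ⊤) ∧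
    ((¬ ∃ e : A, IsUnitElement e) → lieNormalizer I = I) := by
  let Φ : FunctionModel A X := functionModel hA
  refine ⟨fun e he => le_antisymm (fun m hm => ?_) (sup_le hI.le_lieNormalizer ?_),
    fun hne => le_antisymm (fun m hm => ?_) hI.le_lieNormalizer⟩
  · have he0 : e ≠ 0 := by
      rintro rfl
      obtain ⟨a, ha⟩ := @exists_ne A hA.nontrivial 0
      exact ha (by rw [← (he a).1, zero_mul])
    obtain ⟨φ, hφ⟩ : ∃ φ : StrongDual ℂ A, φ e = 1 := by
      obtain ⟨φ, -, hφ⟩ := exists_dual_vector ℂ e (norm_ne_zero_iff.2 he0)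
      refine ⟨((‖e‖ : ℂ)⁻¹) • φ, ?_⟩
      rw [_root_.smul_apply, hφ, smul_eq_mul]
      exact inv_mul_cancel₀ (by simpa using he0)
    -- On the zero set `m x = c • e`, and `φ` reads off `c`. Defining `f` by `φ` on all of `X` makes
    -- it continuous and vanishing at infinity with no extension argument, and a single elementary
    -- tensor suffices.
    let f : C₀(X, ℂ) := (Φ.toFun m).compDual φ
    have h1 : m - MinTensor.tmul e f ∈ I := by
      refine Φ.mem_of_vanishing hA hI fun x hx => ?_
      obtain ⟨c, hc⟩ := hA.exists_eq_smul_unit he (Φ.commute_of_mem_lieNormalizer hm hx)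
      have hf : f x = c := by
        change φ (Φ.toFun m x) = c
        rw [hc, map_smul, hφ, smul_eq_mul, mul_one]
      rw [map_sub, ZeroAtInftyContinuousMap.sub_apply, Φ.apply_tmul, hf, hc, sub_self]
    rw [← sub_add_cancel m (MinTensor.tmul e f)]
    exact Submodule.add_mem_sup h1
      (Submodule.subset_span ⟨e, Submodule.mem_span_singleton_self e, f, trivial, rfl⟩)
  · refine Submodule.span_le.2 ?_
    rintro _ ⟨a, ha, f, -, rfl⟩ m
    obtain ⟨c, rfl⟩ := Submodule.mem_span_singleton.1 ha
    have : MinTensor.tmul (c • e) f * m = m * MinTensor.tmul (c • e) f := Φ.ext fun x => by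
      simp only [Φ.apply_mul, Φ.apply_tmul, smul_mul_assoc, mul_smul_comm, (he _).1, (he _).2]
    rw [this, sub_self]
    exact I.zero_mem
  -- A nonzero value on the zero set would be a nonzero central element and would force a unit.
  · refine Φ.mem_of_vanishing hA hI fun x hx => ?_
    by_contra h
    exact hne (hA.exists_unit_of_central (Φ.commute_of_mem_lieNormalizer hm hx) h)
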